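/- Let $|\theta|<1$ and $|\rho|<1$, and let $X_n=\theta X_{n-1}+\varepsilon_n$, $\varepsilon_n=\rho\,\varepsilon_{n-1}+V_n$ for all $n\ge 1$, where the initial values $X_0,\varepsilon_0$ are arbitrary random variables and $(V_n)_{n\ge1}$ is a sequence of independent and identically distributed random variables with mean zero, positive variance and $\mathbb E[V_1^4]<\infty$. For $n\ge1$ let $$\widehat\theta_n=\frac{\sum_{k=1}^n X_kX_{k-1}}{\sum_{k=1}^n X_{k-1}^2},\qquad \widehat\varepsilon_0=X_0,\qquad \widehat\varepsilon_k=X_k-\widehat\theta_n X_{k-1}\quad(1\le k\le n),$$ and let $$\widehat D_n=\frac{\sum_{k=1}^n(\widehat\varepsilon_k-\widehat\varepsilon_{k-1})^2}{\sum_{k=0}^n\widehat\varepsilon_k^{\,2}}$$ be the Durbin–Watson statistic (a quotient with zero denominator is read as $0$). Put $$D^*=2(1-\rho^*),\qquad \rho^*=\frac{\theta\rho(\theta+\rho)}{1+\theta\rho},\qquad \sigma_D^2=4\sigma_\rho^2,$$ $$\sigma_\rho^2=\frac{1-\theta\rho}{(1+\theta\rho)^3}\Big((\theta+\rho)^2(1+\theta\rho)^2+(\theta\rho)^2(1-\theta^2)(1-\rho^2)\Big).$$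 Then, as $n\to\infty$, $$\sqrt n\,\big(\widehat D_n-D^*\big)\ \xrightarrow{\ \mathcal L\ }\ \mathcal N(0,\sigma_D^2),$$ where $\mathcal N(0,0)$ denotes the Dirac mass at $0$. -/

import Mathlib

open MeasureTheory ProbabilityTheory Filter

noncomputable section

namespace DurbinWatson

/-- The least squares estimator `θ̂_n = (∑_{k=1}^n x_k x_{k-1}) / (∑_{k=1}^n x_{k-1}²)`
computed from an observed trajectory `x`. -/
def thetaHat (x : ℕ → ℝ) (n : ℕ) : ℝ :=
  (∑ k ∈ Finset.Icc 1 n, x k * x (k - 1)) / ∑ k ∈ Finset.Icc 1 n, x (k - 1) ^ 2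

/-- The least squares residuals at step `n`: `ε̂_0 = x_0` and `ε̂_k = x_k - θ̂_n x_{k-1}`
for `k ≥ 1` (the estimator `θ̂_n` is the one at the final step `n`). -/
def residual (x : ℕ → ℝ) (n : ℕ) : ℕ → ℝ
  | 0 => x 0
  | k + 1 => x (k + 1) - thetaHat x n * x k

/-- The Durbin-Watson statistic
`D̂_n = (∑_{k=1}^n (ε̂_k - ε̂_{k-1})²) / (∑_{k=0}^n ε̂_k²)`. -/
def dwStat (x : ℕ → ℝ) (n : ℕ) : ℝ :=
  (∑ k ∈ Finset.Icc 1 n, (residual x n k - residual x n (k - 1)) ^ 2) /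
    ∑ k ∈ Finset.range (n + 1), residual x n k ^ 2

/-- `θ* = (θ + ρ) / (1 + θρ)`. -/
def thetaStar (θ ρ : ℝ) : ℝ := (θ + ρ) / (1 + θ * ρ)

/-- `ρ* = θ ρ θ*`. -/
def rhoStar (θ ρ : ℝ) : ℝ := θ * ρ * thetaStar θ ρ

/-- `D* = 2 (1 - ρ*)`. -/
def dStar (θ ρ : ℝ) : ℝ := 2 * (1 - rhoStar θ ρ)

/-- The variance `σ_ρ²`. -/
def sigmaRhoSq (θ ρ : ℝ) : ℝ :=
  (1 - θ * ρ) / (1 + θ * ρ) ^ 3 *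
    ((θ + ρ) ^ 2 * (1 + θ * ρ) ^ 2 + (θ * ρ) ^ 2 * (1 - θ ^ 2) * (1 - ρ ^ 2))

/-- The variance `σ_D² = 4 σ_ρ²`. -/
def sigmaDSq (θ ρ : ℝ) : ℝ := 4 * sigmaRhoSq θ ρ

/-- `σ_D²` is nonnegative in the stable case, so that passing to `ℝ≥0` loses nothing. -/
theorem sigmaDSq_nonneg {θ ρ : ℝ} (hθ : |θ| < 1) (hρ : |ρ| < 1) : 0 ≤ sigmaDSq θ ρ := by
  have h : |θ * ρ| < 1 := by
    rw [abs_mul]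
    exact mul_lt_one_of_nonneg_of_lt_one_left (abs_nonneg _) hθ hρ.le
  obtain ⟨h1, h2⟩ := abs_lt.mp h
  have h3 : 0 ≤ 1 - θ ^ 2 := by
    have := (sq_lt_one_iff_abs_lt_one θ).mpr hθ
    linarith
  have h4 : 0 ≤ 1 - ρ ^ 2 := by
    have := (sq_lt_one_iff_abs_lt_one ρ).mpr hρ
    linarith
  have h5 : 0 ≤ 1 - θ * ρ := by linarith
  have h6 : 0 ≤ 1 + θ * ρ := by linarith
  unfold sigmaDSq sigmaRhoSq
  positivity

end DurbinWatson

end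

/-!
# Asymptotic normality of the Durbin-Watson statistic

Write `a = θ + ρ` and `b = θ ρ`, and let `y k = x (k - 1)` with `y 0 = 0`. From time two on, the
observed process satisfies `x (k + 1) = a x k - b y k + V (k + 1)`.

The algebra is exact. Let `S = ∑ x k ^ 2`, let `t` be the least squares estimate, and let `l₁`, `l₂`
be the sums of `x k`, `y k` against the innovations, corrected by boundary terms. The two sample
Yule-Walker equations (`sumLagOne_eq`, `sumLagTwo_eq`) turn the centred statistic into
`-2 ((b (1 - t ^ 2) / (1 + b) + t ^ 2) l₁ - t l₂)` plus boundary terms, divided by the residual sum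
of squares `S (1 - t ^ 2) + x n ^ 2` (`dwStat_sub_mul_residualSumSq`, `residualSumSq_eq`). So no
delta method is needed: it suffices that `t → θ*` and `S / n → γ₀` in probability, and that
`l₁ / √n`, `l₂ / √n` and the boundary terms are bounded in probability. The first two follow from
the energy balance `sumSq_balance`, in which only `∑ V k ^ 2` is of order `n`, and from the first
Yule-Walker equation.

The initial values may depend on the noise, so martingale arguments apply only after removing them.
The process is a linear process in the noise plus a transient `θ ^ n X₀ + ρ u n ε₀`, with
`u = arCoeff θ ρ`, that is absolutely summable (`observed_eq_linProc`); its contribution to `l₁`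
and `l₂` is `O_P(1)`. What remains is a single sum `∑ Y k W k` with `W k = V (k + 1)` and
`Y` a linear process in the past noise, whose coefficients `dwCoeff` combine the impulse responses
at lags one and two.

The central limit theorem for `∑ Y k W k` is proved with characteristic functions
(`tendstoInDistribution_inv_sqrt_mul_sum_of_mixing`). Each summand multiplies the characteristic
function by `1 - h ^ 2 s / 2`, up to a third order term and to the fluctuation of the conditional
variance; the latter averages out because shifting time back by a fixed lag changes the phase
little, while the conditional variance given the distant past is almost constant. Summing the
squares of the coefficients (`sq_mul_tsum_dwCoeff_sq`) gives the variance `4 σ_ρ ^ 2`.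
-/

namespace DurbinWatson

/-! ### Boundedness and convergence in probability -/

open scoped ENNReal Topology

variable {Ω : Type*} [MeasurableSpace Ω] {μ : Measure Ω}

/-- Boundedness in probability (`f n = O_P(1)`) of a sequence of real random variables: up to an
event of arbitrarily small probability, `|f n|` is eventually below a fixed constant. -/
def BddInProb (μ : Measure Ω) (f : ℕ → Ω → ℝ) : Prop :=
  ∀ δ : ℝ≥0∞, 0 < δ → ∃ K : ℝ, ∀ᶠ n in atTop, μ {ω | K ≤ |f n ω|} ≤ δ

lemma tendstoInMeasure_const_iff {f : ℕ → Ω → ℝ} {c : ℝ} :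
    TendstoInMeasure μ f atTop (fun _ => c) ↔
      ∀ ε : ℝ, 0 < ε → ∀ δ : ℝ≥0∞, 0 < δ → ∀ᶠ n in atTop, μ {ω | ε ≤ |f n ω - c|} ≤ δ := by
  simp only [tendstoInMeasure_iff_norm, ENNReal.tendsto_nhds_zero, Real.norm_eq_abs, gt_iff_lt]

lemma BddInProb.mono {f g : ℕ → Ω → ℝ} (hg : BddInProb μ g)
    (h : ∀ᶠ n in atTop, ∀ ω, |f n ω| ≤ |g n ω|) : BddInProb μ f := by
  intro δ hδ
  obtain ⟨K, hK⟩ := hg δ hδ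
  refine ⟨K, ?_⟩
  filter_upwards [hK, h] with n hn h'
  exact (measure_mono fun ω (hω : K ≤ _) => hω.trans (h' ω)).trans hn

lemma BddInProb.congr {f g : ℕ → Ω → ℝ} (hg : BddInProb μ g)
    (h : ∀ᶠ n in atTop, ∀ ω, f n ω = g n ω) : BddInProb μ f :=
  hg.mono (h.mono fun _ hn ω => (congrArg abs (hn ω)).le)

/-- Two-argument transfer: if large values of `h` force `f` or `g` to be large, boundedness in
probability passes from `f` and `g` to `h`. -/
lemma BddInProb.of_two {f g h : ℕ → Ω → ℝ} (hf : BddInProb μ f) (hg : BddInProb μ g)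
    (H : ∀ K L : ℝ, ∃ M : ℝ, ∀ n ω, |f n ω| < K → |g n ω| < L → |h n ω| < M) :
    BddInProb μ h := by
  intro δ hδ
  obtain ⟨K, hK⟩ := hf (δ / 2) (ENNReal.half_pos hδ.ne')
  obtain ⟨L, hL⟩ := hg (δ / 2) (ENNReal.half_pos hδ.ne')
  obtain ⟨M, hM⟩ := H K L
  refine ⟨M, ?_⟩
  filter_upwards [hK, hL] with n hn hn'
  have hsub : {ω | M ≤ |h n ω|} ⊆ {ω | K ≤ |f n ω|} ∪ {ω | L ≤ |g n ω|} := by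
    intro ω (hω : M ≤ |h n ω|)
    by_contra hcon
    simp only [Set.mem_union, Set.mem_ofPred_eq, not_or, not_le] at hcon
    exact absurd (hM n ω hcon.1 hcon.2) (not_lt.2 hω)
  calc μ {ω | M ≤ |h n ω|} ≤ μ {ω | K ≤ |f n ω|} + μ {ω | L ≤ |g n ω|} :=
        (measure_mono hsub).trans (measure_union_le _ _)
    _ ≤ δ / 2 + δ / 2 := add_le_add hn hn'
    _ = δ := ENNReal.add_halves δ

lemma BddInProb.add {f g : ℕ → Ω → ℝ} (hf : BddInProb μ f) (hg : BddInProb μ g) :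
    BddInProb μ (fun n ω => f n ω + g n ω) :=
  hf.of_two hg fun K L => ⟨K + L, fun _ _ h1 h2 =>
    (abs_add_le _ _).trans_lt (add_lt_add h1 h2)⟩

lemma BddInProb.mul {f g : ℕ → Ω → ℝ} (hf : BddInProb μ f) (hg : BddInProb μ g) :
    BddInProb μ (fun n ω => f n ω * g n ω) :=
  hf.of_two hg fun K L => ⟨K * L, fun n ω h1 h2 => by
    rw [abs_mul]
    exact mul_lt_mul'' h1 h2 (abs_nonneg _) (abs_nonneg _)⟩

lemma BddInProb.const [IsFiniteMeasure μ] (c : ℝ) : BddInProb μ (fun _ _ => c) := by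
  intro δ hδ
  refine ⟨|c| + 1, Eventually.of_forall fun _ => ?_⟩
  simp [show ¬ (1 : ℝ) ≤ 0 by norm_num]

lemma BddInProb.const_mul [IsFiniteMeasure μ] {f : ℕ → Ω → ℝ} (c : ℝ) (hf : BddInProb μ f) :
    BddInProb μ (fun n ω => c * f n ω) :=
  (BddInProb.const c).mul hf

lemma BddInProb.sub [IsFiniteMeasure μ] {f g : ℕ → Ω → ℝ} (hf : BddInProb μ f)
    (hg : BddInProb μ g) : BddInProb μ (fun n ω => f n ω - g n ω) :=
  (hf.add (hg.const_mul (-1))).congr (Eventually.of_forall fun n ω => by ring)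

lemma BddInProb.of_sq {f : ℕ → Ω → ℝ} (hf : BddInProb μ (fun n ω => f n ω ^ 2)) :
    BddInProb μ f :=
  hf.of_two hf fun K _ => ⟨K + 1, fun n ω h _ => by
    rw [abs_of_nonneg (sq_nonneg _)] at h
    nlinarith [sq_abs (f n ω), sq_nonneg (|f n ω| - 1)]⟩

/-- A constant sequence of finite random variables is bounded in probability. -/
lemma BddInProb.of_randomVariable [IsFiniteMeasure μ] {f : Ω → ℝ} (hf : AEMeasurable f μ) :
    BddInProb μ (fun _ => f) := by
  have h : TendstoInMeasure μ (fun (n : ℕ) ω => (1 / ((n : ℝ) + 1)) * f ω) atTop (fun _ => 0) := by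
    refine tendstoInMeasure_of_tendsto_ae (fun n => (hf.const_mul _).aestronglyMeasurable)
      (Eventually.of_forall fun ω => ?_)
    simpa using tendsto_one_div_add_atTop_nhds_zero_nat.mul_const (f ω)
  intro δ hδ
  obtain ⟨n, hn⟩ := (tendstoInMeasure_const_iff.1 h 1 one_pos δ hδ).exists
  refine ⟨n + 1, Eventually.of_forall fun _ => (measure_mono fun ω hω => ?_).trans hn⟩
  have h1 : (0 : ℝ) < n + 1 := by positivity
  simp only [Set.mem_ofPred_eq, sub_zero, abs_mul, abs_of_pos (one_div_pos.2 h1)] at hω ⊢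
  rwa [one_div, ← div_eq_inv_mul, le_div_iff₀ h1, one_mul]

/-- Markov's inequality: an `L¹`-bounded sequence is bounded in probability. -/
lemma BddInProb.of_integral_abs_le {f : ℕ → Ω → ℝ} {C : ℝ}
    (hint : ∀ n, Integrable (f n) μ) (hC : ∀ n, ∫ ω, |f n ω| ∂μ ≤ C) : BddInProb μ f := by
  intro δ hδ
  have hC0 : 0 ≤ C := (integral_nonneg fun _ => abs_nonneg _).trans (hC 0)
  obtain ⟨N, hN⟩ : ∃ N : ℕ, ENNReal.ofReal (C / (N + 1)) ≤ δ := by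
    have h : Tendsto (fun N : ℕ => ENNReal.ofReal (C * (1 / ((N : ℝ) + 1)))) atTop (𝓝 0) := by
      have := ENNReal.tendsto_ofReal
        (tendsto_one_div_add_atTop_nhds_zero_nat (𝕜 := ℝ) |>.const_mul C)
      simpa using this
    obtain ⟨N, hN⟩ := (ENNReal.tendsto_nhds_zero.1 h δ hδ).exists
    exact ⟨N, by simpa [div_eq_mul_inv] using hN⟩
  refine ⟨N + 1, Eventually.of_forall fun n => ?_⟩
  have hN0 : (0 : ℝ) < N + 1 := by positivity
  refine le_trans ?_ hN
  have h1 := meas_ge_le_lintegral_div (μ := μ) (f := fun ω => ENNReal.ofReal |f n ω|)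
    (by exact (hint n).aemeasurable.abs.ennreal_ofReal) (ε := ENNReal.ofReal (N + 1))
    (by simpa using hN0) ENNReal.ofReal_ne_top
  rw [← ofReal_integral_eq_lintegral_ofReal (hint n).abs
    (Eventually.of_forall fun _ => abs_nonneg _), ← ENNReal.ofReal_div_of_pos hN0] at h1
  refine le_trans (measure_mono fun ω hω => ?_) (h1.trans (ENNReal.ofReal_le_ofReal ?_))
  · exact ENNReal.ofReal_le_ofReal hω
  · gcongr
    exact hC n

/-- `O_P(1) · o_P(1) = o_P(1)`. -/
lemma BddInProb.mul_tendsto_zero {f g : ℕ → Ω → ℝ} (hf : BddInProb μ f)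
    (hg : TendstoInMeasure μ g atTop (fun _ => 0)) :
    TendstoInMeasure μ (fun n ω => f n ω * g n ω) atTop (fun _ => 0) := by
  rw [tendstoInMeasure_const_iff] at hg ⊢
  intro ε hε δ hδ
  obtain ⟨K, hK⟩ := hf (δ / 2) (ENNReal.half_pos hδ.ne')
  filter_upwards [hK, hg (ε / (|K| + 1)) (by positivity) (δ / 2) (ENNReal.half_pos hδ.ne')]
    with n hn hn'
  have hsub : {ω | ε ≤ |f n ω * g n ω - 0|} ⊆
      {ω | K ≤ |f n ω|} ∪ {ω | ε / (|K| + 1) ≤ |g n ω - 0|} := by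
    intro ω hω
    by_contra hcon
    simp only [Set.mem_union, Set.mem_ofPred_eq, not_or, not_le, sub_zero, abs_mul] at hcon hω
    have h1 : |f n ω| < |K| + 1 := by linarith [le_abs_self K, hcon.1]
    have := mul_lt_mul'' h1 hcon.2 (abs_nonneg _) (abs_nonneg _)
    rw [mul_div_cancel₀ _ (by positivity)] at this
    linarith
  calc _ ≤ μ {ω | K ≤ |f n ω|} + μ {ω | ε / (|K| + 1) ≤ |g n ω - 0|} :=
        (measure_mono hsub).trans (measure_union_le _ _)
    _ ≤ δ / 2 + δ / 2 := add_le_add hn hn'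
    _ = δ := ENNReal.add_halves δ

lemma tendstoInMeasure_of_tendsto {a : ℕ → ℝ} {c : ℝ} (h : Tendsto a atTop (𝓝 c)) :
    TendstoInMeasure μ (fun n _ => a n) atTop (fun _ => c) := by
  rw [tendstoInMeasure_const_iff]
  intro ε hε δ hδ
  filter_upwards [Metric.tendsto_nhds.1 h ε hε] with n hn
  have : {ω : Ω | ε ≤ |a n - c|} = ∅ := by
    ext ω
    simpa [Real.dist_eq] using hn
  simp [this]

lemma BddInProb.tendsto_zero_mul {f : ℕ → Ω → ℝ} {a : ℕ → ℝ} (hf : BddInProb μ f)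
    (ha : Tendsto a atTop (𝓝 0)) :
    TendstoInMeasure μ (fun n ω => a n * f n ω) atTop (fun _ => 0) := by
  simpa only [mul_comm] using hf.mul_tendsto_zero (tendstoInMeasure_of_tendsto ha)

lemma tendstoInMeasure_congr_left {f g : ℕ → Ω → ℝ} {c : ℝ}
    (hf : TendstoInMeasure μ f atTop (fun _ => c))
    (h : ∀ᶠ n in atTop, ∀ ω, g n ω = f n ω) : TendstoInMeasure μ g atTop (fun _ => c) :=
  hf.congr' (h.mono fun _ hn => Eventually.of_forall fun ω => (hn ω).symm) EventuallyEq.rfl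

lemma tendstoInMeasure_iff_sub {f : ℕ → Ω → ℝ} {c : ℝ} :
    TendstoInMeasure μ f atTop (fun _ => c) ↔
      TendstoInMeasure μ (fun n ω => f n ω - c) atTop (fun _ => 0) := by
  simp only [tendstoInMeasure_const_iff, sub_zero]

lemma tendstoInMeasure_add {f g : ℕ → Ω → ℝ} {c d : ℝ}
    (hf : TendstoInMeasure μ f atTop (fun _ => c)) (hg : TendstoInMeasure μ g atTop (fun _ => d)) :
    TendstoInMeasure μ (fun n ω => f n ω + g n ω) atTop (fun _ => c + d) := by
  rw [tendstoInMeasure_const_iff] at *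
  intro ε hε δ hδ
  filter_upwards [hf (ε / 2) (half_pos hε) (δ / 2) (ENNReal.half_pos hδ.ne'),
    hg (ε / 2) (half_pos hε) (δ / 2) (ENNReal.half_pos hδ.ne')] with n hn hn'
  have hsub : {ω | ε ≤ |f n ω + g n ω - (c + d)|} ⊆
      {ω | ε / 2 ≤ |f n ω - c|} ∪ {ω | ε / 2 ≤ |g n ω - d|} := by
    intro ω hω
    by_contra hcon
    simp only [Set.mem_union, Set.mem_ofPred_eq, not_or, not_le] at hcon hω
    have := abs_add_le (f n ω - c) (g n ω - d)
    rw [show f n ω - c + (g n ω - d) = f n ω + g n ω - (c + d) by ring] at this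
    linarith [hcon.1, hcon.2]
  calc _ ≤ μ {ω | ε / 2 ≤ |f n ω - c|} + μ {ω | ε / 2 ≤ |g n ω - d|} :=
        (measure_mono hsub).trans (measure_union_le _ _)
    _ ≤ δ / 2 + δ / 2 := add_le_add hn hn'
    _ = δ := ENNReal.add_halves δ

/-- Continuous mapping theorem for convergence in probability to a constant. -/
lemma tendstoInMeasure_comp {f : ℕ → Ω → ℝ} {c : ℝ} {g : ℝ → ℝ}
    (hf : TendstoInMeasure μ f atTop (fun _ => c)) (hg : ContinuousAt g c) :
    TendstoInMeasure μ (fun n ω => g (f n ω)) atTop (fun _ => g c) := by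
  rw [tendstoInMeasure_const_iff] at *
  intro ε hε δ hδ
  obtain ⟨η, hη, H⟩ := Metric.continuousAt_iff.1 hg ε hε
  filter_upwards [hf η hη δ hδ] with n hn
  refine (measure_mono fun ω hω => ?_).trans hn
  by_contra hcon
  simp only [Set.mem_ofPred_eq, not_le] at hcon hω
  exact absurd (H (by simpa [Real.dist_eq] using hcon)) (by simpa [Real.dist_eq] using hω)

lemma tendstoInMeasure_const_mul {f : ℕ → Ω → ℝ} {c : ℝ} (a : ℝ)
    (hf : TendstoInMeasure μ f atTop (fun _ => c)) :
    TendstoInMeasure μ (fun n ω => a * f n ω) atTop (fun _ => a * c) :=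
  tendstoInMeasure_comp (g := fun x => a * x) hf (by fun_prop)

lemma BddInProb.of_tendstoInMeasure [IsFiniteMeasure μ] {f : ℕ → Ω → ℝ} {c : ℝ}
    (hf : TendstoInMeasure μ f atTop (fun _ => c)) : BddInProb μ f := by
  have h : BddInProb μ (fun n ω => f n ω - c) := fun δ hδ =>
    ⟨1, tendstoInMeasure_const_iff.1 hf 1 one_pos δ hδ⟩
  exact (h.add (BddInProb.const c)).congr (Eventually.of_forall fun n ω => by ring)

lemma tendstoInMeasure_mul [IsFiniteMeasure μ] {f g : ℕ → Ω → ℝ} {c d : ℝ}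
    (hf : TendstoInMeasure μ f atTop (fun _ => c)) (hg : TendstoInMeasure μ g atTop (fun _ => d)) :
    TendstoInMeasure μ (fun n ω => f n ω * g n ω) atTop (fun _ => c * d) := by
  rw [tendstoInMeasure_iff_sub]
  have h1 := (BddInProb.of_tendstoInMeasure hg).mul_tendsto_zero (tendstoInMeasure_iff_sub.1 hf)
  have h2 := tendstoInMeasure_const_mul c (tendstoInMeasure_iff_sub.1 hg)
  have h3 := tendstoInMeasure_add h1 h2
  simp only [mul_zero, add_zero] at h3
  exact tendstoInMeasure_congr_left h3 (Eventually.of_forall fun n ω => by ring)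

lemma tendstoInMeasure_div [IsFiniteMeasure μ] {f g : ℕ → Ω → ℝ} {c d : ℝ}
    (hf : TendstoInMeasure μ f atTop (fun _ => c)) (hg : TendstoInMeasure μ g atTop (fun _ => d))
    (hd : d ≠ 0) :
    TendstoInMeasure μ (fun n ω => f n ω / g n ω) atTop (fun _ => c / d) := by
  simp only [div_eq_mul_inv]
  exact tendstoInMeasure_mul hf (tendstoInMeasure_comp hg (continuousAt_inv₀ hd))

end DurbinWatson

namespace DurbinWatson

/-! ### A central limit theorem for martingale-like sums -/

open scoped ENNReal Topology
open Complex (I)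

variable {Ω : Type*} [MeasurableSpace Ω] {μ : Measure Ω}

lemma norm_cexp_mul_I_sub_taylor_two_le (x : ℝ) :
    ‖Complex.exp (x * I) - 1 - x * I + (x : ℂ) ^ 2 / 2‖ ≤ 4 * |x| ^ 3 := by
  rcases le_or_gt |x| 1 with hx | hx
  · have hn : ‖(x : ℂ) * I‖ = |x| := by simp
    have h := Complex.exp_bound (x := (x : ℂ) * I) (by rw [hn]; exact hx) (n := 3) (by norm_num)
    rw [hn] at h
    simp only [Finset.sum_range_succ, Finset.sum_range_zero] at h
    norm_num [Nat.factorial, mul_pow] at h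
    have h2 : Complex.exp (x * I) - 1 - x * I + (x : ℂ) ^ 2 / 2 =
        Complex.exp (x * I) - (1 + x * I + -(x : ℂ) ^ 2 / 2) := by ring
    rw [h2]
    refine h.trans ?_
    have : 0 ≤ |x| ^ 3 := by positivity
    linarith
  · have h1 : ‖Complex.exp (x * I)‖ = 1 := Complex.norm_exp_ofReal_mul_I x
    have h2 : ‖(x : ℂ) * I‖ = |x| := by simp
    have h3 : ‖(x : ℂ) ^ 2 / 2‖ = |x| ^ 2 / 2 := by simp
    have h4 : ‖(1 : ℂ)‖ = 1 := by simp
    calc _ ≤ ‖Complex.exp (x * I)‖ + ‖(1 : ℂ)‖ + ‖(x : ℂ) * I‖ + ‖(x : ℂ) ^ 2 / 2‖ := by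
          refine (norm_add_le _ _).trans (add_le_add_left ?_ _)
          exact (norm_sub_le _ _).trans (add_le_add_left (norm_sub_le _ _) _)
      _ = 1 + 1 + |x| + |x| ^ 2 / 2 := by rw [h1, h2, h3, h4]
      _ ≤ 4 * |x| ^ 3 := by
          nlinarith [mul_pos (sub_pos.2 hx) (sub_pos.2 hx), pow_pos (zero_lt_one.trans hx) 2,
            mul_pos (pow_pos (zero_lt_one.trans hx) 2) (sub_pos.2 hx)]

lemma norm_cexp_mul_I_sub_one_le (x : ℝ) : ‖Complex.exp (x * I) - 1‖ ≤ |x| := by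
  rw [mul_comm]
  simpa using Real.norm_exp_I_mul_ofReal_sub_one_le (x := x)

lemma norm_cexp_mul_I_sub_cexp_le (x y : ℝ) :
    ‖Complex.exp (x * I) - Complex.exp (y * I)‖ ≤ |x - y| := by
  have h : Complex.exp (x * I) - Complex.exp (y * I) =
      Complex.exp (y * I) * (Complex.exp ((x - y : ℝ) * I) - 1) := by
    rw [mul_sub, ← Complex.exp_add, mul_one]
    congr 2
    push_cast
    ring
  rw [h, norm_mul, Complex.norm_exp_ofReal_mul_I, one_mul]
  exact norm_cexp_mul_I_sub_one_le _

lemma aestronglyMeasurable_cexp {T : Ω → ℝ} (hT : Measurable T) (h : ℝ) :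
    AEStronglyMeasurable (fun ω => Complex.exp ((h * T ω : ℝ) * I)) μ := by
  refine Measurable.aestronglyMeasurable ?_
  fun_prop

lemma integrable_cexp_mul {T f : Ω → ℝ} (hT : Measurable T) (hf : Integrable f μ) (h : ℝ) :
    Integrable (fun ω => Complex.exp ((h * T ω : ℝ) * I) * (f ω : ℂ)) μ := by
  refine Integrable.bdd_mul (c := 1) hf.ofReal (aestronglyMeasurable_cexp hT h)
    (Eventually.of_forall fun ω => ?_)
  rw [Complex.norm_exp_ofReal_mul_I]

lemma norm_integral_cexp_mul_le {T f : Ω → ℝ} (h : ℝ) :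
    ‖∫ ω, Complex.exp ((h * T ω : ℝ) * I) * (f ω : ℂ) ∂μ‖ ≤ ∫ ω, |f ω| ∂μ := by
  refine (norm_integral_le_integral_norm _).trans (le_of_eq ?_)
  simp only [norm_mul, Complex.norm_exp_ofReal_mul_I, one_mul, Complex.norm_real,
    Real.norm_eq_abs]

lemma abs_pow_le_one_add_abs_pow_three (x : ℝ) : |x| ≤ 1 + |x| ^ 3 ∧ x ^ 2 ≤ 1 + |x| ^ 3 := by
  have h0 := abs_nonneg x
  rw [← sq_abs x]
  generalize |x| = y at *
  rcases le_or_gt y 1 with h | h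
  · have : 0 ≤ y ^ 3 := by positivity
    constructor <;> nlinarith
  · have : 0 < y * y := by positivity
    constructor <;> nlinarith [mul_pos this (sub_pos.2 h)]

lemma integrable_abs_pow_three {Z : Ω → ℝ} (hZ : MemLp Z 3 μ) :
    Integrable (fun ω => |Z ω| ^ 3) μ := by
  have := hZ.integrable_norm_rpow (by norm_num) (by norm_num)
  simpa using this

variable [IsProbabilityMeasure μ]

/-- One step of the characteristic function recursion: a summand `Z` that is conditionally
centred multiplies the characteristic function by `1 - h² s² / 2`, up to the defect of the
conditional variance and a third order remainder. -/
lemma norm_charFun_step_le {T Z : Ω → ℝ} (hT : Measurable T) (hZm : Measurable Z)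
    (hZ : MemLp Z 3 μ) (s h : ℝ)
    (h0 : ∫ ω, Complex.exp ((h * T ω : ℝ) * I) * (Z ω : ℂ) ∂μ = 0) :
    ‖∫ ω, Complex.exp ((h * (T ω + Z ω) : ℝ) * I) ∂μ -
        (1 - h ^ 2 * s / 2 : ℝ) * ∫ ω, Complex.exp ((h * T ω : ℝ) * I) ∂μ‖ ≤
      h ^ 2 / 2 * ‖∫ ω, Complex.exp ((h * T ω : ℝ) * I) * ((Z ω ^ 2 - s : ℝ) : ℂ) ∂μ‖ +
        4 * |h| ^ 3 * ∫ ω, |Z ω| ^ 3 ∂μ := by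
  have hZ1 : Integrable Z μ := hZ.integrable (by norm_num)
  have hZ2 : Integrable (fun ω => Z ω ^ 2) μ :=
    (hZ.mono_exponent (by norm_num : (2 : ℝ≥0∞) ≤ 3)).integrable_sq
  have hZs : Integrable (fun ω => Z ω ^ 2 - s) μ := hZ2.sub (integrable_const s)
  set e : Ω → ℂ := fun ω => Complex.exp ((h * T ω : ℝ) * I) with he
  have i1 := integrable_cexp_mul hT hZ1 h
  have i2 := integrable_cexp_mul hT hZs h
  have i0 : Integrable e μ := by
    simpa [he] using integrable_cexp_mul hT (integrable_const (μ := μ) (1 : ℝ)) h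
  have i3 : Integrable (fun ω => Complex.exp ((h * (T ω + Z ω) : ℝ) * I)) μ := by
    simpa using integrable_cexp_mul (hT.add hZm) (integrable_const (μ := μ) (1 : ℝ)) h
  have key : ∀ ω, Complex.exp ((h * (T ω + Z ω) : ℝ) * I) - (1 - h ^ 2 * s / 2 : ℝ) * e ω -
      (h * I) * (e ω * (Z ω : ℂ)) + ((h ^ 2 / 2 : ℝ) : ℂ) * (e ω * ((Z ω ^ 2 - s : ℝ) : ℂ)) =
      e ω * (Complex.exp ((h * Z ω : ℝ) * I) - 1 - (h * Z ω : ℝ) * I +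
        ((h * Z ω : ℝ) : ℂ) ^ 2 / 2) := by
    intro ω
    have : Complex.exp ((h * (T ω + Z ω) : ℝ) * I) = e ω * Complex.exp ((h * Z ω : ℝ) * I) := by
      rw [he, ← Complex.exp_add]
      congr 1
      push_cast
      ring
    rw [this]
    push_cast
    ring
  have hsum : ∫ ω, Complex.exp ((h * (T ω + Z ω) : ℝ) * I) ∂μ -
      (1 - h ^ 2 * s / 2 : ℝ) * ∫ ω, e ω ∂μ =
      -(((h ^ 2 / 2 : ℝ) : ℂ) * ∫ ω, e ω * ((Z ω ^ 2 - s : ℝ) : ℂ) ∂μ) +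
      ∫ ω, e ω * (Complex.exp ((h * Z ω : ℝ) * I) - 1 - (h * Z ω : ℝ) * I +
        ((h * Z ω : ℝ) : ℂ) ^ 2 / 2) ∂μ := by
    simp_rw [← key]
    rw [integral_add, integral_sub, integral_sub, integral_const_mul, integral_const_mul,
      integral_const_mul, h0]
    · ring
    · exact i3
    · exact i0.const_mul _
    · exact i3.sub (i0.const_mul _)
    · exact i1.const_mul _
    · exact (i3.sub (i0.const_mul _)).sub (i1.const_mul _)
    · exact i2.const_mul _
  rw [hsum]
  refine (norm_add_le _ _).trans (add_le_add (le_of_eq ?_) ?_)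
  · rw [norm_neg, norm_mul, Complex.norm_real, Real.norm_of_nonneg (by positivity)]
  · rw [← integral_const_mul]
    refine norm_integral_le_of_norm_le ((integrable_abs_pow_three hZ).const_mul _)
      (Eventually.of_forall fun ω => ?_)
    rw [norm_mul, he, Complex.norm_exp_ofReal_mul_I, one_mul]
    refine (norm_cexp_mul_I_sub_taylor_two_le _).trans (le_of_eq ?_)
    rw [abs_mul, mul_pow]
    ring

/-- Decoupling: for a sum `T k` of the `Z j`, shifting the time in the characteristic function by
`m` steps costs at most `|h| m` times a constant, so the conditional variance of `Z (k + m)` given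
the distant past controls the conditional variance given the immediate past. -/
lemma norm_integral_cexp_mul_sq_sub_le {Z : ℕ → Ω → ℝ} (hZm : ∀ k, Measurable (Z k))
    (hZ : ∀ k, MemLp (Z k) 3 μ) {C : ℝ} (hC : ∀ k, ∫ ω, |Z k ω| ^ 3 ∂μ ≤ C) {s : ℝ} (hs : 0 ≤ s)
    (h : ℝ) (k m : ℕ) :
    ‖∫ ω, Complex.exp ((h * ∑ j ∈ Finset.range (k + m), Z j ω : ℝ) * I) *
        ((Z (k + m) ω ^ 2 - s : ℝ) : ℂ) ∂μ‖ ≤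
      ‖∫ ω, Complex.exp ((h * ∑ j ∈ Finset.range k, Z j ω : ℝ) * I) *
        ((Z (k + m) ω ^ 2 - s : ℝ) : ℂ) ∂μ‖ + |h| * m * (2 * C + s * (1 + C)) := by
  have hZ2 : Integrable (fun ω => Z (k + m) ω ^ 2) μ :=
    ((hZ _).mono_exponent (by norm_num : (2 : ℝ≥0∞) ≤ 3)).integrable_sq
  have hZs : Integrable (fun ω => Z (k + m) ω ^ 2 - s) μ := hZ2.sub (integrable_const s)
  have hT : ∀ k, Measurable (fun ω => ∑ j ∈ Finset.range k, Z j ω) := fun k =>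
    Finset.measurable_sum _ fun j _ => hZm j
  have i1 := integrable_cexp_mul (hT (k + m)) hZs h
  have i2 := integrable_cexp_mul (hT k) hZs h
  -- the product bound `a b² ≤ a³ + b³`
  have hab : ∀ a b : ℝ, 0 ≤ a → 0 ≤ b → a * b ^ 2 ≤ a ^ 3 + b ^ 3 := by
    intro a b ha hb
    rcases le_total a b with hle | hle
    · have : a * b ^ 2 ≤ b * b ^ 2 := by gcongr
      nlinarith [pow_nonneg ha 3]
    · have : a * b ^ 2 ≤ a * a ^ 2 := by gcongr
      nlinarith [pow_nonneg hb 3]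
  set G : Ω → ℝ := fun ω => ∑ j ∈ Finset.range m,
    (|Z (k + j) ω| ^ 3 + |Z (k + m) ω| ^ 3 + s * (1 + |Z (k + j) ω| ^ 3)) with hG
  have hGj : ∀ j, Integrable (fun ω => |Z (k + j) ω| ^ 3 + |Z (k + m) ω| ^ 3 +
      s * (1 + |Z (k + j) ω| ^ 3)) μ := fun j =>
    ((integrable_abs_pow_three (hZ _)).add (integrable_abs_pow_three (hZ _))).add
      (((integrable_const 1).add (integrable_abs_pow_three (hZ _))).const_mul s)
  have hGi : Integrable G μ := integrable_finsetSum _ fun j _ => hGj j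
  have hGint : ∫ ω, G ω ∂μ ≤ m * (2 * C + s * (1 + C)) := by
    rw [hG, integral_finsetSum _ fun j _ => hGj j]
    have : ∀ j ∈ Finset.range m, ∫ ω, |Z (k + j) ω| ^ 3 + |Z (k + m) ω| ^ 3 +
        s * (1 + |Z (k + j) ω| ^ 3) ∂μ ≤ 2 * C + s * (1 + C) := by
      intro j _
      rw [integral_add, integral_add, integral_const_mul, integral_add]
      · have h1 := hC (k + j)
        have h2 := hC (k + m)
        have h3 := mul_le_mul_of_nonneg_left h1 hs
        simp only [integral_const, probReal_univ, smul_eq_mul, one_mul]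
        linarith
      · exact integrable_const 1
      · exact integrable_abs_pow_three (hZ _)
      · exact integrable_abs_pow_three (hZ _)
      · exact integrable_abs_pow_three (hZ _)
      · exact (integrable_abs_pow_three (hZ _)).add (integrable_abs_pow_three (hZ _))
      · exact ((integrable_const 1).add (integrable_abs_pow_three (hZ _))).const_mul s
    refine (Finset.sum_le_sum this).trans (le_of_eq ?_)
    rw [Finset.sum_const, Finset.card_range, nsmul_eq_mul]
  have hdiff : ‖∫ ω, (Complex.exp ((h * ∑ j ∈ Finset.range (k + m), Z j ω : ℝ) * I) *
        ((Z (k + m) ω ^ 2 - s : ℝ) : ℂ) -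
      Complex.exp ((h * ∑ j ∈ Finset.range k, Z j ω : ℝ) * I) *
        ((Z (k + m) ω ^ 2 - s : ℝ) : ℂ)) ∂μ‖ ≤ ∫ ω, |h| * G ω ∂μ := by
    refine norm_integral_le_of_norm_le (hGi.const_mul _) (Eventually.of_forall fun ω => ?_)
    rw [← sub_mul, norm_mul, Complex.norm_real, Real.norm_eq_abs]
    have h1 : |h * ∑ j ∈ Finset.range (k + m), Z j ω - h * ∑ j ∈ Finset.range k, Z j ω| ≤
        |h| * ∑ j ∈ Finset.range m, |Z (k + j) ω| := by
      rw [← mul_sub, abs_mul, Finset.sum_range_add, add_sub_cancel_left]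
      gcongr
      exact Finset.abs_sum_le_sum_abs _ _
    have h2 : |Z (k + m) ω ^ 2 - s| ≤ |Z (k + m) ω| ^ 2 + s := by
      refine (abs_sub _ _).trans (le_of_eq ?_)
      rw [abs_of_nonneg hs, abs_pow]
    calc _ ≤ (|h| * ∑ j ∈ Finset.range m, |Z (k + j) ω|) * (|Z (k + m) ω| ^ 2 + s) :=
          mul_le_mul ((norm_cexp_mul_I_sub_cexp_le _ _).trans h1) h2 (abs_nonneg _)
            (by positivity)
      _ = |h| * ∑ j ∈ Finset.range m, |Z (k + j) ω| * (|Z (k + m) ω| ^ 2 + s) := by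
          rw [mul_assoc, Finset.sum_mul]
      _ ≤ |h| * G ω := by
          refine mul_le_mul_of_nonneg_left (Finset.sum_le_sum fun j _ => ?_) (abs_nonneg _)
          have h3 := hab _ _ (abs_nonneg (Z (k + j) ω)) (abs_nonneg (Z (k + m) ω))
          have h4 := mul_le_mul_of_nonneg_left (abs_pow_le_one_add_abs_pow_three (Z (k + j) ω)).1 hs
          linarith
  rw [integral_sub i1 i2, integral_const_mul] at hdiff
  have h5 := mul_le_mul_of_nonneg_left hGint (abs_nonneg h)
  have h6 := norm_sub_norm_le
    (∫ ω, Complex.exp ((h * ∑ j ∈ Finset.range (k + m), Z j ω : ℝ) * I) *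
        ((Z (k + m) ω ^ 2 - s : ℝ) : ℂ) ∂μ)
    (∫ ω, Complex.exp ((h * ∑ j ∈ Finset.range k, Z j ω : ℝ) * I) *
        ((Z (k + m) ω ^ 2 - s : ℝ) : ℂ) ∂μ)
  rw [mul_assoc]
  linarith

lemma norm_sub_pow_le_sum {φ : ℕ → ℂ} (hφ : φ 0 = 1) {l : ℝ} (hl : |l| ≤ 1) (n : ℕ) :
    ‖φ n - (l : ℂ) ^ n‖ ≤ ∑ k ∈ Finset.range n, ‖φ (k + 1) - l * φ k‖ := by
  induction n with
  | zero => simp [hφ]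
  | succ n ih =>
    rw [Finset.sum_range_succ]
    have h : φ (n + 1) - (l : ℂ) ^ (n + 1) = l * (φ n - (l : ℂ) ^ n) + (φ (n + 1) - l * φ n) := by
      ring
    rw [h]
    refine (norm_add_le _ _).trans (add_le_add_left ?_ _)
    rw [norm_mul, Complex.norm_real, Real.norm_eq_abs]
    exact (mul_le_of_le_one_left (norm_nonneg _) hl).trans ih

/-- The characteristic function of a sum of conditionally centred variables against the
`n`-th power `(1 - h² s / 2) ^ n`, where `m` is a free lag. -/
lemma norm_charFun_sum_sub_pow_le {Z : ℕ → Ω → ℝ} (hZm : ∀ k, Measurable (Z k))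
    (hZ : ∀ k, MemLp (Z k) 3 μ) {C : ℝ} (hC : ∀ k, ∫ ω, |Z k ω| ^ 3 ∂μ ≤ C) {s : ℝ} (hs : 0 ≤ s)
    {δ : ℕ → ℝ}
    (hmart : ∀ k (h : ℝ), ∫ ω, Complex.exp ((h * ∑ j ∈ Finset.range k, Z j ω : ℝ) * I) *
      (Z k ω : ℂ) ∂μ = 0)
    (hmix : ∀ m k (h : ℝ), ‖∫ ω, Complex.exp ((h * ∑ j ∈ Finset.range k, Z j ω : ℝ) * I) *
        ((Z (k + m) ω ^ 2 - s : ℝ) : ℂ) ∂μ‖ ≤ δ m)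
    (h : ℝ) (hh : |1 - h ^ 2 * s / 2| ≤ 1) (m n : ℕ) :
    ‖∫ ω, Complex.exp ((h * ∑ j ∈ Finset.range n, Z j ω : ℝ) * I) ∂μ -
        ((1 - h ^ 2 * s / 2 : ℝ) : ℂ) ^ n‖ ≤
      n * (h ^ 2 / 2 * (δ m + |h| * m * (2 * C + s * (1 + C))) + 4 * |h| ^ 3 * C) +
        m * (h ^ 2 / 2 * (1 + C + s)) := by
  have hT : ∀ k, Measurable (fun ω => ∑ j ∈ Finset.range k, Z j ω) := fun k =>
    Finset.measurable_sum _ fun j _ => hZm j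
  have hC0 : 0 ≤ C := (integral_nonneg fun _ => by positivity).trans (hC 0)
  have hδ0 : 0 ≤ δ m := (norm_nonneg _).trans (hmix m 0 0)
  refine (norm_sub_pow_le_sum (φ := fun n =>
    ∫ ω, Complex.exp ((h * ∑ j ∈ Finset.range n, Z j ω : ℝ) * I) ∂μ) (by simp) hh n).trans ?_
  set a := h ^ 2 / 2 * (δ m + |h| * m * (2 * C + s * (1 + C))) + 4 * |h| ^ 3 * C with ha
  set b := h ^ 2 / 2 * (1 + C + s) with hb
  have hb0 : 0 ≤ b := by positivity
  have hstep : ∀ k ∈ Finset.range n,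
      ‖∫ ω, Complex.exp ((h * ∑ j ∈ Finset.range (k + 1), Z j ω : ℝ) * I) ∂μ -
        ((1 - h ^ 2 * s / 2 : ℝ) : ℂ) *
          ∫ ω, Complex.exp ((h * ∑ j ∈ Finset.range k, Z j ω : ℝ) * I) ∂μ‖ ≤
      a + if k < m then b else 0 := by
    intro k _
    have h1 := norm_charFun_step_le (hT k) (hZm k) (hZ k) s h (hmart k h)
    simp_rw [← Finset.sum_range_succ] at h1
    have h3 : 4 * |h| ^ 3 * ∫ ω, |Z k ω| ^ 3 ∂μ ≤ 4 * |h| ^ 3 * C :=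
      mul_le_mul_of_nonneg_left (hC k) (by positivity)
    refine h1.trans ?_
    split_ifs with hk
    · have h2 : ‖∫ ω, Complex.exp ((h * ∑ j ∈ Finset.range k, Z j ω : ℝ) * I) *
          ((Z k ω ^ 2 - s : ℝ) : ℂ) ∂μ‖ ≤ 1 + C + s := by
        refine (norm_integral_cexp_mul_le h).trans ?_
        have hint' : Integrable (fun ω => 1 + |Z k ω| ^ 3) μ :=
          (integrable_const 1).add (integrable_abs_pow_three (hZ k))
        have hint : Integrable (fun ω => 1 + |Z k ω| ^ 3 + s) μ := hint'.add (integrable_const s)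
        have hle : ∫ ω, |Z k ω ^ 2 - s| ∂μ ≤ ∫ ω, (1 + |Z k ω| ^ 3 + s) ∂μ := by
          refine integral_mono_of_nonneg (Eventually.of_forall fun _ => abs_nonneg _) hint
            (Eventually.of_forall fun ω => ?_)
          refine (abs_sub _ _).trans ?_
          rw [abs_of_nonneg hs, abs_of_nonneg (sq_nonneg _)]
          exact add_le_add_left (abs_pow_le_one_add_abs_pow_three (Z k ω)).2 _
        rw [integral_add hint' (integrable_const s), integral_add (integrable_const 1)
          (integrable_abs_pow_three (hZ k))] at hle
        simp only [integral_const, probReal_univ, smul_eq_mul, one_mul] at hle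
        linarith [hC k]
      have h4 := mul_le_mul_of_nonneg_left h2 (by positivity : 0 ≤ h ^ 2 / 2)
      have h5 : 0 ≤ h ^ 2 / 2 * (δ m + |h| * m * (2 * C + s * (1 + C))) := by positivity
      linarith
    · obtain ⟨l, rfl⟩ := Nat.exists_eq_add_of_le' (not_lt.1 hk)
      have h2 := norm_integral_cexp_mul_sq_sub_le hZm hZ hC hs h l m
      have h4 := mul_le_mul_of_nonneg_left (h2.trans (add_le_add_left (hmix m l h) _))
        (by positivity : 0 ≤ h ^ 2 / 2)
      linarith
  refine (Finset.sum_le_sum hstep).trans ?_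
  rw [Finset.sum_add_distrib]
  refine add_le_add (by simp) ?_
  rw [← Finset.sum_filter, Finset.sum_const, nsmul_eq_mul]
  refine mul_le_mul_of_nonneg_right ?_ hb0
  have : ((Finset.range n).filter (fun k => k < m)).card ≤ (Finset.range m).card :=
    Finset.card_le_card fun k hk => by simpa using (Finset.mem_filter.1 hk).2
  exact_mod_cast this.trans (by simp)

/-- **Central limit theorem for martingale-difference-like sequences.** The variables `Z k` are
bounded in `L³`, centred given the partial sum up to `k`, and the conditional variance of
`Z (k + m)` given the partial sum up to `k` is `s` up to an error which vanishes as the lag `m`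
grows, uniformly in `k`. -/
theorem tendstoInDistribution_inv_sqrt_mul_sum_of_mixing {Z : ℕ → Ω → ℝ}
    (hZm : ∀ k, Measurable (Z k))
    (hZ : ∀ k, MemLp (Z k) 3 μ) {C : ℝ} (hC : ∀ k, ∫ ω, |Z k ω| ^ 3 ∂μ ≤ C) {s : ℝ} (hs : 0 ≤ s)
    {δ : ℕ → ℝ} (hδ : Tendsto δ atTop (𝓝 0))
    (hmart : ∀ k (h : ℝ), ∫ ω, Complex.exp ((h * ∑ j ∈ Finset.range k, Z j ω : ℝ) * I) *
      (Z k ω : ℂ) ∂μ = 0)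
    (hmix : ∀ m k (h : ℝ), ‖∫ ω, Complex.exp ((h * ∑ j ∈ Finset.range k, Z j ω : ℝ) * I) *
        ((Z (k + m) ω ^ 2 - s : ℝ) : ℂ) ∂μ‖ ≤ δ m) :
    TendstoInDistribution (fun (n : ℕ) ω => (√n)⁻¹ * ∑ k ∈ Finset.range n, Z k ω) atTop
      (id : ℝ → ℝ) (fun _ => μ) (gaussianReal 0 s.toNNReal) where
  forall_aemeasurable n :=
    ((Finset.measurable_sum _ fun j _ => hZm j).const_mul _).aemeasurable
  aemeasurable_limit := aemeasurable_id
  tendsto := by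
    refine ProbabilityMeasure.tendsto_iff_tendsto_charFun.2 fun t => ?_
    have hlim : charFun ((gaussianReal 0 s.toNNReal).map id) t =
        Complex.exp ((-(t ^ 2 * s / 2) : ℝ) : ℂ) := by
      rw [Measure.map_id, charFun_gaussianReal]
      congr 1
      push_cast [Real.coe_toNNReal s hs]
      ring
    have hchar : ∀ n : ℕ, charFun (μ.map fun ω => (√n)⁻¹ * ∑ k ∈ Finset.range n, Z k ω) t =
        ∫ ω, Complex.exp (((√n)⁻¹ * t * ∑ k ∈ Finset.range n, Z k ω : ℝ) * I) ∂μ := by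
      intro n
      rw [charFun_apply_real, integral_map]
      · refine integral_congr_ae (Eventually.of_forall fun ω => ?_)
        simp only
        congr 1
        push_cast
        ring
      · exact ((Finset.measurable_sum _ fun j _ => hZm j).const_mul _).aemeasurable
      · exact Measurable.aestronglyMeasurable (by fun_prop)
    simp only [ProbabilityMeasure.coe_mk]
    rw [hlim]
    simp_rw [hchar]
    have hsqrt : Tendsto (fun n : ℕ => (√(n : ℝ))⁻¹) atTop (𝓝 0) :=
      tendsto_inv_atTop_zero.comp (Real.tendsto_sqrt_atTop.comp tendsto_natCast_atTop_atTop)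
    have hsq : ∀ n : ℕ, n ≠ 0 → ((√(n : ℝ))⁻¹ * t) ^ 2 = t ^ 2 / n := by
      intro n _
      rw [mul_pow, inv_pow, Real.sq_sqrt (Nat.cast_nonneg n)]
      ring
    have hpow : Tendsto (fun n : ℕ => ((1 - ((√(n : ℝ))⁻¹ * t) ^ 2 * s / 2 : ℝ) : ℂ) ^ n) atTop
        (𝓝 (Complex.exp ((-(t ^ 2 * s / 2) : ℝ) : ℂ))) := by
      refine (Complex.tendsto_one_add_div_pow_exp _).congr' ?_
      filter_upwards [eventually_ne_atTop 0] with n hn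
      rw [hsq n hn]
      congr 1
      push_cast
      ring
    have hdiff : Tendsto (fun n : ℕ =>
        ∫ ω, Complex.exp (((√n)⁻¹ * t * ∑ k ∈ Finset.range n, Z k ω : ℝ) * I) ∂μ -
        ((1 - ((√(n : ℝ))⁻¹ * t) ^ 2 * s / 2 : ℝ) : ℂ) ^ n) atTop (𝓝 0) := by
      rw [Metric.tendsto_nhds]
      intro ε hε
      have h1 : Tendsto (fun m => t ^ 2 / 2 * δ m) atTop (𝓝 0) := by
        simpa using hδ.const_mul (t ^ 2 / 2)
      obtain ⟨m, hm⟩ := (h1.eventually_lt_const hε).exists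
      have hub : Tendsto (fun n : ℕ => t ^ 2 / 2 * (δ m + (√(n : ℝ))⁻¹ * (|t| * m *
          (2 * C + s * (1 + C)))) + 4 * t ^ 2 * |t| * C * (√(n : ℝ))⁻¹ +
          m * (t ^ 2 / 2 * (1 + C + s)) * (n : ℝ)⁻¹) atTop (𝓝 (t ^ 2 / 2 * (δ m + 0 * (|t| * m *
          (2 * C + s * (1 + C)))) + 4 * t ^ 2 * |t| * C * 0 +
          m * (t ^ 2 / 2 * (1 + C + s)) * 0)) :=
        (((hsqrt.mul_const _).const_add _).const_mul _ |>.add (hsqrt.const_mul _)).add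
          (tendsto_natCast_atTop_atTop.inv_tendsto_atTop.const_mul _)
      have hsmall : Tendsto (fun n : ℕ => ((√(n : ℝ))⁻¹ * t) ^ 2 * s / 2) atTop (𝓝 0) := by
        have := (((hsqrt.mul_const t).pow 2).mul_const s).div_const 2
        simpa using this
      filter_upwards [hub.eventually_lt_const (by simpa using hm : _ < ε), eventually_ne_atTop 0,
        hsmall.eventually_le_const (by norm_num : (0 : ℝ) < 2)] with n hn hn0 hn1
      rw [dist_zero_right]
      have hpos : (0 : ℝ) < n := by positivity
      refine (norm_charFun_sum_sub_pow_le hZm hZ hC hs hmart hmix _ ?_ m n).trans_lt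
        (lt_of_eq_of_lt ?_ hn)
      · rw [abs_le]
        have : 0 ≤ ((√(n : ℝ))⁻¹ * t) ^ 2 * s / 2 := by positivity
        constructor <;> linarith
      · have h3 : |(√(n : ℝ))⁻¹ * t| ^ 3 = t ^ 2 / n * ((√(n : ℝ))⁻¹ * |t|) := by
          rw [pow_succ, sq_abs, hsq n hn0, abs_mul, abs_of_nonneg (by positivity)]
        rw [h3, hsq n hn0, abs_mul, abs_of_nonneg (by positivity : 0 ≤ (√(n : ℝ))⁻¹)]
        field_simp
    simpa using hdiff.add hpow

end DurbinWatson

namespace DurbinWatson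

/-! ### Linear processes driven by centred i.i.d. noise -/

open scoped ENNReal Topology
open Complex (I)

variable {Ω : Type*}

/-- A sequence of independent and identically distributed real random variables with mean zero,
variance `v` and a finite third absolute moment. -/
structure CenteredIID [MeasurableSpace Ω] (W : ℕ → Ω → ℝ) (v : ℝ) (μ : Measure Ω) : Prop where
  measurable : ∀ k, Measurable (W k)
  indep : iIndepFun W μ
  ident : ∀ k, IdentDistrib (W k) (W 0) μ μ
  memLp_zero : MemLp (W 0) 3 μ
  integral_zero : ∫ ω, W 0 ω ∂μ = 0
  integral_sq_zero : ∫ ω, W 0 ω ^ 2 ∂μ = v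

/-- The linear process `Y k = ∑_{i < k} c (k - 1 - i) W i` driven by the noise `W` up to
time `k - 1`. -/
def linProc (c : ℕ → ℝ) (W : ℕ → Ω → ℝ) (k : ℕ) (ω : Ω) : ℝ :=
  ∑ i ∈ Finset.range k, c (k - 1 - i) * W i ω

/-- The σ-algebra generated by `W i`, `i < k`. -/
@[reducible] def past (W : ℕ → Ω → ℝ) (k : ℕ) : MeasurableSpace Ω :=
  ⨆ i ∈ Set.Iio k, MeasurableSpace.comap (W i) inferInstance

/-- The σ-algebra generated by `W i`, `i ≥ k`. -/
@[reducible] def future (W : ℕ → Ω → ℝ) (k : ℕ) : MeasurableSpace Ω :=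
  ⨆ i ∈ Set.Ici k, MeasurableSpace.comap (W i) inferInstance

lemma summable_mul_of_summable_abs {c d : ℕ → ℝ} (hc : Summable fun j => |c j|)
    (hd : Summable fun j => |d j|) : Summable fun j => c j * d j := by
  refine Summable.of_norm_bounded (hc.mul_right (∑' j, |d j|)) fun j => ?_
  rw [Real.norm_eq_abs, abs_mul]
  exact mul_le_mul_of_nonneg_left (hd.le_tsum j fun _ _ => abs_nonneg _) (abs_nonneg _)

lemma summable_sq_of_summable_abs {c : ℕ → ℝ} (hc : Summable fun j => |c j|) :
    Summable fun j => c j ^ 2 := by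
  simpa only [sq] using summable_mul_of_summable_abs hc hc

lemma measurable_sum_const_mul {m : MeasurableSpace Ω} {s : Finset ℕ} {f : ℕ → Ω → ℝ} (a : ℕ → ℝ)
    (hf : ∀ i ∈ s, Measurable (f i)) : Measurable (fun ω => ∑ i ∈ s, a i * f i ω) :=
  Finset.measurable_sum _ fun i hi => (hf i hi).const_mul _

lemma measurable_sum_mul {m : MeasurableSpace Ω} {s : Finset ℕ} {f g : ℕ → Ω → ℝ}
    (hf : ∀ i ∈ s, Measurable (f i)) (hg : ∀ i ∈ s, Measurable (g i)) :
    Measurable (fun ω => ∑ i ∈ s, f i ω * g i ω) :=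
  Finset.measurable_sum _ fun i hi => (hf i hi).mul (hg i hi)

lemma measurable_comp_pair {α : Type*} [MeasurableSpace α] {m : MeasurableSpace Ω} {f g : Ω → ℝ}
    (hf : Measurable f) (hg : Measurable g) {F : ℝ × ℝ → α} (hF : Measurable F) :
    Measurable (fun ω => F (f ω, g ω)) :=
  hF.comp (hf.prodMk hg)

lemma measurable_past (W : ℕ → Ω → ℝ) {i k : ℕ} (h : i < k) : Measurable[past W k] (W i) := by
  rw [measurable_iff_comap_le]
  exact le_biSup (fun i => MeasurableSpace.comap (W i) inferInstance) (show i ∈ Set.Iio k from h)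

lemma measurable_future (W : ℕ → Ω → ℝ) {i k : ℕ} (h : k ≤ i) :
    Measurable[future W k] (W i) := by
  rw [measurable_iff_comap_le]
  exact le_biSup (fun i => MeasurableSpace.comap (W i) inferInstance) (show i ∈ Set.Ici k from h)

lemma measurable_past_linProc (c : ℕ → ℝ) (W : ℕ → Ω → ℝ) {j k : ℕ} (h : j ≤ k) :
    Measurable[past W k] (linProc c W j) := by
  unfold linProc
  exact measurable_sum_const_mul _ fun i hi =>
    measurable_past W ((Finset.mem_range.1 hi).trans_le h)

lemma measurable_past_sum (c : ℕ → ℝ) (W : ℕ → Ω → ℝ) (k : ℕ) :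
    Measurable[past W k] (fun ω => ∑ j ∈ Finset.range k, linProc c W j ω * W j ω) := by
  exact measurable_sum_mul
    (fun i hi => measurable_past_linProc c W (Finset.mem_range.1 hi).le)
    (fun i hi => measurable_past W (Finset.mem_range.1 hi))

lemma linProc_add (c : ℕ → ℝ) (W : ℕ → Ω → ℝ) (k m : ℕ) (ω : Ω) :
    linProc c W (k + m) ω = linProc (fun j => c (j + m)) W k ω +
      ∑ j ∈ Finset.range m, c (m - 1 - j) * W (k + j) ω := by
  unfold linProc
  rw [Finset.sum_range_add]
  congr 1
  · refine Finset.sum_congr rfl fun i hi => ?_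
    have := Finset.mem_range.1 hi
    rw [show k + m - 1 - i = k - 1 - i + m by omega]
  · refine Finset.sum_congr rfl fun i hi => ?_
    have := Finset.mem_range.1 hi
    rw [show k + m - 1 - (k + i) = m - 1 - i by omega]

namespace CenteredIID

variable [MeasurableSpace Ω] {μ : Measure Ω} {W : ℕ → Ω → ℝ} {v : ℝ} (hW : CenteredIID W v μ)
include hW

lemma indep_past_future (k : ℕ) : Indep (past W k) (future W k) μ :=
  indep_iSup_of_disjoint (fun i => (hW.measurable i).comap_le) hW.indep
    (Set.disjoint_left.2 fun _ (h1 : _ < k) (h2 : k ≤ _) => absurd h1 (not_lt.2 h2))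

lemma indepFun_of_past_future {α β : Type*} [MeasurableSpace α] [MeasurableSpace β] {k : ℕ}
    {f : Ω → α} {g : Ω → β}
    (hf : Measurable[past W k] f) (hg : Measurable[future W k] g) : IndepFun f g μ := by
  rw [IndepFun_iff_Indep]
  exact indep_of_indep_of_le_left (indep_of_indep_of_le_right (hW.indep_past_future k)
    hg.comap_le) hf.comap_le

lemma past_le (k : ℕ) : past W k ≤ ‹MeasurableSpace Ω› :=
  iSup₂_le fun i _ => (hW.measurable i).comap_le

lemma memLp (k : ℕ) : MemLp (W k) 3 μ := (hW.ident k).memLp_iff.2 hW.memLp_zero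

lemma integral_eq_zero (k : ℕ) : ∫ ω, W k ω ∂μ = 0 :=
  (hW.ident k).integral_eq.trans hW.integral_zero

lemma integral_sq (k : ℕ) : ∫ ω, W k ω ^ 2 ∂μ = v := by
  have := ((hW.ident k).comp (u := fun x => x ^ 2) (by fun_prop)).integral_eq
  exact this.trans hW.integral_sq_zero

lemma variance_nonneg : 0 ≤ v := hW.integral_sq_zero ▸ integral_nonneg fun _ => sq_nonneg _

lemma measurable_linProc (c : ℕ → ℝ) (k : ℕ) : Measurable (linProc c W k) :=
  Finset.measurable_sum _ fun i _ => (hW.measurable i).const_mul _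

lemma integral_mul_of_ne {i j : ℕ} (h : i ≠ j) : ∫ ω, W i ω * W j ω ∂μ = 0 := by
  rw [(hW.indep.indepFun h).integral_fun_mul_eq_mul_integral
    (hW.measurable i).aestronglyMeasurable (hW.measurable j).aestronglyMeasurable,
    hW.integral_eq_zero, zero_mul]

lemma memLp_linProc (c : ℕ → ℝ) (k : ℕ) : MemLp (linProc c W k) 3 μ :=
  memLp_finsetSum _ fun i _ => (hW.memLp i).const_mul _

lemma measurable_linProc_mul (c : ℕ → ℝ) (k : ℕ) :
    Measurable (fun ω => linProc c W k ω * W k ω) :=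
  (hW.measurable_linProc c k).mul (hW.measurable k)

lemma indepFun_linProc (c : ℕ → ℝ) (k : ℕ) : IndepFun (linProc c W k) (W k) μ :=
  hW.indepFun_of_past_future (measurable_past_linProc c W le_rfl) (measurable_future W le_rfl)

lemma integral_abs_linProc_pow_three_le {c : ℕ → ℝ} (hc : Summable fun j => |c j|) (k : ℕ) :
    ∫ ω, |linProc c W k ω| ^ 3 ∂μ ≤ ((∑' j, |c j|) * (eLpNorm (W 0) 3 μ).toReal) ^ 3 := by
  set B := (eLpNorm (W 0) 3 μ).toReal with hB
  have hWk : ∀ i, eLpNorm (W i) 3 μ = ENNReal.ofReal B := fun i => by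
    rw [hB, ENNReal.ofReal_toReal hW.memLp_zero.eLpNorm_ne_top, (hW.ident i).eLpNorm_eq]
  have hS0 : 0 ≤ ∑' j, |c j| := tsum_nonneg fun _ => abs_nonneg _
  have h1 : eLpNorm (linProc c W k) 3 μ ≤ ENNReal.ofReal ((∑' j, |c j|) * B) := by
    have h2 : linProc c W k = ∑ i ∈ Finset.range k, fun ω => c (k - 1 - i) * W i ω := by
      ext ω
      simp [linProc]
    rw [h2]
    refine (eLpNorm_sum_le (fun i _ => ((hW.measurable i).const_mul _).aestronglyMeasurable)
      (by norm_num)).trans ?_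
    have h3 : ∀ i, eLpNorm (fun ω => c (k - 1 - i) * W i ω) 3 μ =
        ENNReal.ofReal (|c (k - 1 - i)| * B) := by
      intro i
      have := eLpNorm_const_smul (c (k - 1 - i)) (W i) 3 μ
      rw [ENNReal.ofReal_mul (abs_nonneg _), ← hWk i, ← Real.enorm_eq_ofReal_abs]
      exact this
    simp_rw [h3]
    rw [← ENNReal.ofReal_sum_of_nonneg fun i _ => by positivity, ← Finset.sum_mul,
      Finset.sum_range_reflect (fun j => |c j|)]
    refine ENNReal.ofReal_le_ofReal (mul_le_mul_of_nonneg_right ?_ ENNReal.toReal_nonneg)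
    exact hc.sum_le_tsum _ fun _ _ => abs_nonneg _
  rw [(hW.memLp_linProc c k).eLpNorm_eq_integral_rpow_norm (by norm_num) (by norm_num),
    ENNReal.ofReal_le_ofReal_iff (by positivity)] at h1
  have h4 := pow_le_pow_left₀ (by positivity) h1 3
  rw [← Real.rpow_natCast, ← Real.rpow_mul (by positivity)] at h4
  norm_num at h4
  exact h4

lemma integral_linProc_mul_sq (c : ℕ → ℝ) (k : ℕ) :
    ∫ ω, (linProc c W k ω * W k ω) ^ 2 ∂μ = v * ∫ ω, linProc c W k ω ^ 2 ∂μ := by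
  have h := (hW.indepFun_linProc c k).comp (φ := fun x => x ^ 2) (ψ := fun x => x ^ 2)
    (by fun_prop) (by fun_prop)
  have := h.integral_fun_mul_eq_mul_integral
    ((hW.measurable_linProc c k).pow_const 2).aestronglyMeasurable
    ((hW.measurable k).pow_const 2).aestronglyMeasurable
  simp only [Function.comp_def] at this
  simp_rw [mul_pow]
  rw [this, hW.integral_sq, mul_comm]

lemma memLp_linProc_mul (c : ℕ → ℝ) (k : ℕ) :
    MemLp (fun ω => linProc c W k ω * W k ω) 3 μ := by
  have h := (hW.indepFun_linProc c k).comp (φ := fun x => |x| ^ 3) (ψ := fun x => |x| ^ 3)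
    (by fun_prop) (by fun_prop)
  have := h.integrable_mul (integrable_abs_pow_three (hW.memLp_linProc c k))
    (integrable_abs_pow_three (hW.memLp k))
  refine (integrable_norm_rpow_iff (hW.measurable_linProc_mul c k).aestronglyMeasurable
    (by norm_num) (by norm_num)).1 (this.congr (Eventually.of_forall fun ω => ?_))
  simp [mul_pow]

lemma integral_abs_linProc_mul_pow_three_le {c : ℕ → ℝ} (hc : Summable fun j => |c j|) (k : ℕ) :
    ∫ ω, |linProc c W k ω * W k ω| ^ 3 ∂μ ≤
      ((∑' j, |c j|) * (eLpNorm (W 0) 3 μ).toReal) ^ 3 * ∫ ω, |W 0 ω| ^ 3 ∂μ := by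
  have h := (hW.indepFun_linProc c k).comp (φ := fun x => |x| ^ 3) (ψ := fun x => |x| ^ 3)
    (by fun_prop) (by fun_prop)
  have := h.integral_fun_mul_eq_mul_integral
    ((hW.measurable_linProc c k).abs.pow_const 3).aestronglyMeasurable
    ((hW.measurable k).abs.pow_const 3).aestronglyMeasurable
  simp only [Function.comp_def] at this
  simp_rw [abs_mul]
  conv_lhs => enter [2, ω]; rw [mul_pow]
  rw [this]
  have h3 : ∫ ω, |W k ω| ^ 3 ∂μ = ∫ ω, |W 0 ω| ^ 3 ∂μ :=
    ((hW.ident k).comp (u := fun x => |x| ^ 3) (by fun_prop)).integral_eq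
  rw [h3]
  exact mul_le_mul_of_nonneg_right (hW.integral_abs_linProc_pow_three_le hc k)
    (integral_nonneg fun _ => by positivity)

lemma integral_cexp_mul_linProc_mul (c : ℕ → ℝ) (k : ℕ) (h : ℝ) :
    ∫ ω, Complex.exp ((h * ∑ j ∈ Finset.range k, linProc c W j ω * W j ω : ℝ) * I) *
      ((linProc c W k ω * W k ω : ℝ) : ℂ) ∂μ = 0 := by
  have hm : Measurable[past W k] (fun ω =>
      Complex.exp ((h * ∑ j ∈ Finset.range k, linProc c W j ω * W j ω : ℝ) * I) *
        (linProc c W k ω : ℂ)) := by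
    have h1 := measurable_past_sum c W k
    have h2 := measurable_past_linProc c W (le_refl k)
    have h3 : Measurable (fun p : ℝ × ℝ => Complex.exp ((h * p.1 : ℝ) * I) * (p.2 : ℂ)) := by
      fun_prop
    exact measurable_comp_pair h1 h2 h3
  have hi := hW.indepFun_of_past_future hm
    (g := fun ω => (W k ω : ℂ)) (Complex.measurable_ofReal.comp (measurable_future W le_rfl))
  have := hi.integral_fun_mul_eq_mul_integral
    (hm.mono (hW.past_le k) le_rfl).aestronglyMeasurable
    (Complex.measurable_ofReal.comp (hW.measurable k)).aestronglyMeasurable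
  rw [integral_complex_ofReal, hW.integral_eq_zero, Complex.ofReal_zero, mul_zero] at this
  rw [← this]
  refine integral_congr_ae (Eventually.of_forall fun ω => ?_)
  simp only [Complex.ofReal_mul]
  ring

variable [IsProbabilityMeasure μ]

lemma memLp_two (k : ℕ) : MemLp (W k) 2 μ := (hW.memLp k).mono_exponent (by norm_num)

lemma integral_sum_sq (s : Finset ℕ) (a : ℕ → ℝ) :
    ∫ ω, (∑ i ∈ s, a i * W i ω) ^ 2 ∂μ = v * ∑ i ∈ s, a i ^ 2 := by
  have hint : ∀ i j, Integrable (fun ω => a i * W i ω * (a j * W j ω)) μ := fun i j =>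
    ((hW.memLp_two i).const_mul (a i)).integrable_mul ((hW.memLp_two j).const_mul (a j))
  simp_rw [sq, Finset.sum_mul_sum]
  rw [integral_finsetSum _ fun i _ => integrable_finsetSum _ fun j _ => hint i j, Finset.mul_sum]
  refine Finset.sum_congr rfl fun i hi => ?_
  rw [integral_finsetSum _ fun j _ => hint i j, Finset.sum_eq_single_of_mem i hi]
  · rw [← hW.integral_sq i, mul_comm, ← integral_const_mul]
    exact integral_congr_ae (Eventually.of_forall fun ω => by simp only; ring)
  · intro j _ hj
    have : ∀ ω, a i * W i ω * (a j * W j ω) = a i * a j * (W i ω * W j ω) := fun ω => by ring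
    simp_rw [this]
    rw [integral_const_mul, hW.integral_mul_of_ne hj.symm, mul_zero]

lemma integral_linProc_sq (c : ℕ → ℝ) (k : ℕ) :
    ∫ ω, linProc c W k ω ^ 2 ∂μ = v * ∑ j ∈ Finset.range k, c j ^ 2 := by
  unfold linProc
  rw [hW.integral_sum_sq, Finset.sum_range_reflect (fun j => c j ^ 2)]

lemma memLp_two_linProc (c : ℕ → ℝ) (k : ℕ) : MemLp (linProc c W k) 2 μ :=
  (hW.memLp_linProc c k).mono_exponent (by norm_num)

lemma integral_linProc_sq_le {c : ℕ → ℝ} (hc : Summable fun j => c j ^ 2) (k : ℕ) :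
    ∫ ω, linProc c W k ω ^ 2 ∂μ ≤ v * ∑' j, c j ^ 2 := by
  rw [hW.integral_linProc_sq]
  exact mul_le_mul_of_nonneg_left (hc.sum_le_tsum _ fun _ _ => sq_nonneg _) hW.variance_nonneg

/-- The conditional variance of `Y (k + m) W (k + m)` given the noise before time `k`, tested
against a bounded random phase: the part of `Y (k + m)` driven by the last `m` noise variables is
independent of the phase, and the cross term with the remaining part vanishes. -/
lemma integral_cexp_mul_linProc_add_sq (c : ℕ → ℝ) (k m : ℕ) (h : ℝ) {T : Ω → ℝ}
    (hT : Measurable[past W k] T) :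
    ∫ ω, Complex.exp ((h * T ω : ℝ) * I) *
      (((linProc c W (k + m) ω * W (k + m) ω) ^ 2 : ℝ) : ℂ) ∂μ =
      v * ((v * ∑ j ∈ Finset.range m, c j ^ 2) * ∫ ω, Complex.exp ((h * T ω : ℝ) * I) ∂μ +
        ∫ ω, Complex.exp ((h * T ω : ℝ) * I) *
          ((linProc (fun j => c (j + m)) W k ω ^ 2 : ℝ) : ℂ) ∂μ) := by
  have hTm : Measurable T := hT.mono (hW.past_le k) le_rfl
  set Y := linProc c W (k + m) with hY
  set B := linProc (fun j => c (j + m)) W k with hB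
  set A : Ω → ℝ := fun ω => ∑ j ∈ Finset.range m, c (m - 1 - j) * W (k + j) ω with hA
  set e : Ω → ℂ := fun ω => Complex.exp ((h * T ω : ℝ) * I) with he
  have hYAB : ∀ ω, Y ω = B ω + A ω := linProc_add c W k m
  have hmono : past W k ≤ past W (k + m) :=
    biSup_mono fun i (hi : i < k) => (lt_of_lt_of_le hi (Nat.le_add_right k m) : i < k + m)
  have hAf : Measurable[future W k] A := by
    exact measurable_sum_const_mul _ fun i _ => measurable_future W (Nat.le_add_right k i)
  have hAm : Measurable A :=
    Finset.measurable_sum _ fun j _ => (hW.measurable (k + j)).const_mul _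
  have hA2 : MemLp A 2 μ := memLp_finsetSum _ fun j _ => (hW.memLp_two (k + j)).const_mul _
  have hB2 : MemLp B 2 μ := hW.memLp_two_linProc _ k
  have hBm : Measurable B := hW.measurable_linProc _ k
  have hBp : Measurable[past W k] B := measurable_past_linProc _ W le_rfl
  have hep : Measurable (fun x : ℝ => Complex.exp ((h * x : ℝ) * I)) := by fun_prop
  -- the last factor `W (k + m)` is independent of everything else
  have s1 : ∫ ω, e ω * (((Y ω * W (k + m) ω) ^ 2 : ℝ) : ℂ) ∂μ =
      v * ∫ ω, e ω * ((Y ω ^ 2 : ℝ) : ℂ) ∂μ := by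
    have h3 : Measurable (fun p : ℝ × ℝ => Complex.exp ((h * p.1 : ℝ) * I) *
        ((p.2 ^ 2 : ℝ) : ℂ)) := by fun_prop
    have hm : Measurable[past W (k + m)] (fun ω => e ω * ((Y ω ^ 2 : ℝ) : ℂ)) :=
      measurable_comp_pair (hT.mono hmono le_rfl) (measurable_past_linProc c W le_rfl) h3
    have h4 : Measurable (fun x : ℝ => ((x ^ 2 : ℝ) : ℂ)) := by fun_prop
    have hi := hW.indepFun_of_past_future hm
      (h4.comp (measurable_future W (le_refl (k + m))))
    have := hi.integral_fun_mul_eq_mul_integral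
      (hm.mono (hW.past_le _) le_rfl).aestronglyMeasurable
      (h4.comp (hW.measurable (k + m))).aestronglyMeasurable
    simp only [Function.comp_def] at this
    rw [integral_complex_ofReal, hW.integral_sq] at this
    rw [mul_comm, ← this]
    refine integral_congr_ae (Eventually.of_forall fun ω => ?_)
    simp only [Complex.ofReal_mul, Complex.ofReal_pow]
    ring
  -- the cross term
  have s2 : ∫ ω, e ω * ((B ω * A ω : ℝ) : ℂ) ∂μ = 0 := by
    have h3 : Measurable (fun p : ℝ × ℝ => Complex.exp ((h * p.1 : ℝ) * I) * (p.2 : ℂ)) := by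
      fun_prop
    have hm : Measurable[past W k] (fun ω => e ω * (B ω : ℂ)) :=
      measurable_comp_pair hT hBp h3
    have hi := hW.indepFun_of_past_future hm (Complex.measurable_ofReal.comp hAf)
    have := hi.integral_fun_mul_eq_mul_integral
      (hm.mono (hW.past_le _) le_rfl).aestronglyMeasurable
      (Complex.measurable_ofReal.comp hAm).aestronglyMeasurable
    simp only [Function.comp_def] at this
    have hA0 : ∫ ω, A ω ∂μ = 0 := by
      rw [hA, integral_finsetSum _ fun j _ =>
        ((hW.memLp_two (k + j)).integrable (by norm_num)).const_mul _]
      refine Finset.sum_eq_zero fun j _ => ?_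
      rw [integral_const_mul, hW.integral_eq_zero, mul_zero]
    rw [integral_complex_ofReal, hA0, Complex.ofReal_zero, mul_zero] at this
    rw [← this]
    refine integral_congr_ae (Eventually.of_forall fun ω => ?_)
    simp only [Complex.ofReal_mul]
    ring
  -- the recent part
  have s3 : ∫ ω, e ω * ((A ω ^ 2 : ℝ) : ℂ) ∂μ =
      (v * ∑ j ∈ Finset.range m, c j ^ 2) * ∫ ω, e ω ∂μ := by
    have hm : Measurable[past W k] e := hep.comp hT
    have h4 : Measurable (fun x : ℝ => ((x ^ 2 : ℝ) : ℂ)) := by fun_prop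
    have hi := hW.indepFun_of_past_future hm (h4.comp hAf)
    have := hi.integral_fun_mul_eq_mul_integral
      (hm.mono (hW.past_le _) le_rfl).aestronglyMeasurable
      (h4.comp hAm).aestronglyMeasurable
    simp only [Function.comp_def] at this
    have hA2' : ∫ ω, A ω ^ 2 ∂μ = v * ∑ j ∈ Finset.range m, c j ^ 2 := by
      have := hW.integral_sum_sq (Finset.Ico k (k + m)) (fun i => c (m - 1 - (i - k)))
      simp only [Finset.sum_Ico_eq_sum_range, Nat.add_sub_cancel_left] at this
      rw [hA, this, Finset.sum_range_reflect (fun j => c j ^ 2)]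
    rw [this, integral_complex_ofReal, hA2']
    push_cast
    ring
  rw [s1]
  congr 1
  have i1 := integrable_cexp_mul hTm hA2.integrable_sq h
  have i2 := integrable_cexp_mul hTm hB2.integrable_sq h
  have i3 : Integrable (fun ω => 2 * (e ω * ((B ω * A ω : ℝ) : ℂ))) μ :=
    (integrable_cexp_mul hTm (hB2.integrable_mul hA2) h).const_mul 2
  have i4 : Integrable (fun ω => e ω * ((A ω ^ 2 : ℝ) : ℂ) +
      2 * (e ω * ((B ω * A ω : ℝ) : ℂ))) μ := i1.add i3
  have hexp : ∀ ω, e ω * ((Y ω ^ 2 : ℝ) : ℂ) = e ω * ((A ω ^ 2 : ℝ) : ℂ) +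
      2 * (e ω * ((B ω * A ω : ℝ) : ℂ)) + e ω * ((B ω ^ 2 : ℝ) : ℂ) := by
    intro ω
    rw [hYAB]
    push_cast
    ring
  simp_rw [hexp]
  rw [integral_add i4 i2, integral_add i1 i3,
    integral_const_mul, s2, s3]
  ring

/-- **Central limit theorem for `∑ Y k * W k`** where `Y` is a linear process driven by the past
of the noise `W`. -/
theorem tendstoInDistribution_linProc_mul {c : ℕ → ℝ} (hc : Summable fun j => |c j|) :
    TendstoInDistribution
      (fun (n : ℕ) ω => (√n)⁻¹ * ∑ k ∈ Finset.range n, linProc c W k ω * W k ω) atTop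
      (id : ℝ → ℝ) (fun _ => μ) (gaussianReal 0 (v ^ 2 * ∑' j, c j ^ 2).toNNReal) := by
  have hc2 := summable_sq_of_summable_abs hc
  have hv := hW.variance_nonneg
  set S := ∑' j, c j ^ 2 with hS
  have hS0 : 0 ≤ S := tsum_nonneg fun _ => sq_nonneg _
  have hδ : Tendsto (fun m => 2 * v ^ 2 * (S - ∑ j ∈ Finset.range m, c j ^ 2)) atTop (𝓝 0) := by
    have := (hc2.hasSum.tendsto_sum_nat.const_sub S).const_mul (2 * v ^ 2)
    simpa [← hS] using this
  refine tendstoInDistribution_inv_sqrt_mul_sum_of_mixing (hW.measurable_linProc_mul c)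
    (hW.memLp_linProc_mul c) (hW.integral_abs_linProc_mul_pow_three_le hc) (by positivity) hδ
    (hW.integral_cexp_mul_linProc_mul c) fun m k h => ?_
  have hT := measurable_past_sum c W k
  have hTm := hT.mono (hW.past_le k) le_rfl
  have i1 := integrable_cexp_mul hTm
    ((hW.memLp_linProc_mul c (k + m)).mono_exponent
      (by norm_num : (2 : ℝ≥0∞) ≤ 3)).integrable_sq h
  have i0 := integrable_cexp_mul hTm (integrable_const (μ := μ) (v ^ 2 * S)) h
  simp_rw [Complex.ofReal_sub, mul_sub]
  rw [integral_sub i1 i0, hW.integral_cexp_mul_linProc_add_sq c k m h hT, integral_mul_const]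
  set E := ∫ ω, Complex.exp ((h * ∑ j ∈ Finset.range k, linProc c W j ω * W j ω : ℝ) * I) ∂μ
    with hE
  set F := ∫ ω, Complex.exp ((h * ∑ j ∈ Finset.range k, linProc c W j ω * W j ω : ℝ) * I) *
    ((linProc (fun j => c (j + m)) W k ω ^ 2 : ℝ) : ℂ) ∂μ with hF
  set P := ∑ j ∈ Finset.range m, c j ^ 2 with hP
  have hE1 : ‖E‖ ≤ 1 := by
    have := norm_integral_cexp_mul_le (μ := μ) (f := fun _ => 1)
      (T := fun ω => ∑ j ∈ Finset.range k, linProc c W j ω * W j ω) h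
    simpa [hE] using this
  have hF1 : ‖F‖ ≤ v * (S - P) := by
    refine (norm_integral_cexp_mul_le h).trans ?_
    simp_rw [abs_sq]
    rw [hW.integral_linProc_sq]
    refine mul_le_mul_of_nonneg_left ?_ hv
    have h1 : ∑ j ∈ Finset.range (m + k), c j ^ 2 ≤ S := hc2.sum_le_tsum _ fun _ _ => sq_nonneg _
    rw [Finset.sum_range_add] at h1
    simp_rw [add_comm m] at h1
    linarith
  have hPS : 0 ≤ S - P := sub_nonneg.2 (hc2.sum_le_tsum _ fun _ _ => sq_nonneg _)
  have hrw : (v : ℂ) * (v * (P : ℂ) * E + F) - E * ((v ^ 2 * S : ℝ) : ℂ) =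
      v * F - ((v ^ 2 * (S - P) : ℝ) : ℂ) * E := by
    push_cast
    ring
  rw [← Complex.ofReal_mul] at hrw ⊢
  rw [hrw]
  refine (norm_sub_le _ _).trans ?_
  rw [norm_mul, norm_mul, Complex.norm_real, Complex.norm_real, Real.norm_of_nonneg hv,
    Real.norm_of_nonneg (by positivity : 0 ≤ v ^ 2 * (S - P))]
  have h1 := mul_le_mul_of_nonneg_left hF1 hv
  have h2 := mul_le_mul_of_nonneg_left hE1 (by positivity : 0 ≤ v ^ 2 * (S - P))
  nlinarith

/-- Orthogonality of the increments `Y k * W k`. -/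
lemma integral_sum_linProc_mul_sq_le {c : ℕ → ℝ} (hc : Summable fun j => c j ^ 2) (n : ℕ) :
    ∫ ω, (∑ k ∈ Finset.range n, linProc c W k ω * W k ω) ^ 2 ∂μ ≤
      n * (v ^ 2 * ∑' j, c j ^ 2) := by
  induction n with
  | zero => simp
  | succ n ih =>
    have hZ2 : ∀ k, MemLp (fun ω => linProc c W k ω * W k ω) 2 μ := fun k =>
      (hW.memLp_linProc_mul c k).mono_exponent (by norm_num)
    have hT2 : MemLp (fun ω => ∑ k ∈ Finset.range n, linProc c W k ω * W k ω) 2 μ :=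
      memLp_finsetSum _ fun k _ => hZ2 k
    have hm : Measurable[past W n]
        (fun ω => (∑ k ∈ Finset.range n, linProc c W k ω * W k ω) * linProc c W n ω) :=
      measurable_comp_pair (measurable_past_sum c W n) (measurable_past_linProc c W le_rfl)
        measurable_mul
    have hcross : ∫ ω, (∑ k ∈ Finset.range n, linProc c W k ω * W k ω) *
        (linProc c W n ω * W n ω) ∂μ = 0 := by
      have := (hW.indepFun_of_past_future hm
        (measurable_future W (le_refl n))).integral_fun_mul_eq_mul_integral
        (hm.mono (hW.past_le n) le_rfl).aestronglyMeasurable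
        (hW.measurable n).aestronglyMeasurable
      rw [hW.integral_eq_zero, mul_zero] at this
      simpa only [mul_assoc] using this
    have hexp : ∀ ω, (∑ k ∈ Finset.range (n + 1), linProc c W k ω * W k ω) ^ 2 =
        (∑ k ∈ Finset.range n, linProc c W k ω * W k ω) ^ 2 +
        2 * ((∑ k ∈ Finset.range n, linProc c W k ω * W k ω) * (linProc c W n ω * W n ω)) +
        (linProc c W n ω * W n ω) ^ 2 := by
      intro ω
      rw [Finset.sum_range_succ]
      ring
    have icr : Integrable (fun ω => 2 * ((∑ k ∈ Finset.range n, linProc c W k ω * W k ω) *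
        (linProc c W n ω * W n ω))) μ := (hT2.integrable_mul (hZ2 n)).const_mul 2
    have icr' : Integrable (fun ω => (∑ k ∈ Finset.range n, linProc c W k ω * W k ω) ^ 2 +
        2 * ((∑ k ∈ Finset.range n, linProc c W k ω * W k ω) *
          (linProc c W n ω * W n ω))) μ := hT2.integrable_sq.add icr
    simp_rw [hexp]
    rw [integral_add icr' (hZ2 n).integrable_sq,
      integral_add hT2.integrable_sq icr, integral_const_mul]
    rw [hcross, hW.integral_linProc_mul_sq]
    have h1 := mul_le_mul_of_nonneg_left (hW.integral_linProc_sq_le hc n) hW.variance_nonneg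
    push_cast
    nlinarith

lemma bddInProb_inv_sqrt_mul_sum {c : ℕ → ℝ} (hc : Summable fun j => c j ^ 2) :
    BddInProb μ (fun n ω => (√n)⁻¹ * ∑ k ∈ Finset.range n, linProc c W k ω * W k ω) := by
  have hT2 : ∀ n : ℕ, MemLp (fun ω => ∑ k ∈ Finset.range n, linProc c W k ω * W k ω) 2 μ :=
    fun n => memLp_finsetSum _ fun k _ => (hW.memLp_linProc_mul c k).mono_exponent (by norm_num)
  refine BddInProb.of_sq (BddInProb.of_integral_abs_le (C := v ^ 2 * ∑' j, c j ^ 2)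
    (fun n => ((hT2 n).const_mul _).integrable_sq) fun n => ?_)
  simp_rw [abs_sq, mul_pow, inv_pow, Real.sq_sqrt (Nat.cast_nonneg n)]
  rw [integral_const_mul]
  have hnn : 0 ≤ v ^ 2 * ∑' j, c j ^ 2 :=
    mul_nonneg (sq_nonneg _) (tsum_nonneg fun _ => sq_nonneg _)
  rcases Nat.eq_zero_or_pos n with rfl | hn
  · simpa using hnn
  · rw [← div_eq_inv_mul, div_le_iff₀ (by positivity), mul_comm]
    exact hW.integral_sum_linProc_mul_sq_le hc n

lemma bddInProb_linProc {c : ℕ → ℝ} (hc : Summable fun j => c j ^ 2) :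
    BddInProb μ (fun n ω => linProc c W n ω) := by
  refine BddInProb.of_sq (BddInProb.of_integral_abs_le (C := v * ∑' j, c j ^ 2)
    (fun n => (hW.memLp_two_linProc c n).integrable_sq) fun n => ?_)
  simp_rw [abs_sq]
  exact hW.integral_linProc_sq_le hc n

end CenteredIID

end DurbinWatson

namespace DurbinWatson

/-! ### The observed process as a linear process -/

open scoped ENNReal Topology

variable {Ω : Type*}

/-- The impulse response of `X n = θ X (n - 1) + ε n`, `ε n = ρ ε (n - 1) + V n`, shifted by one:
`arCoeff θ ρ l = ∑_{i < l} θ ^ i ρ ^ (l - 1 - i)`. -/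
def arCoeff (θ ρ : ℝ) : ℕ → ℝ
  | 0 => 0
  | l + 1 => θ * arCoeff θ ρ l + ρ ^ l

/-- The sequence `x` delayed by one step, with value `0` at time `0`. -/
def lag (x : ℕ → ℝ) : ℕ → ℝ
  | 0 => 0
  | k + 1 => x k

/-- The innovation of `x` for the second order autoregression with coefficients `a` and `-b`. At
time `0` the missing past value is read as `0`, so that the autoregression holds from the start. -/
def innov (a b : ℝ) (x : ℕ → ℝ) (j : ℕ) : ℝ := x (j + 1) - a * x j + b * lag x j

lemma arCoeff_add_two (θ ρ : ℝ) (l : ℕ) :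
    arCoeff θ ρ (l + 2) = (θ + ρ) * arCoeff θ ρ (l + 1) - θ * ρ * arCoeff θ ρ l := by
  simp only [arCoeff]
  ring

lemma abs_arCoeff_succ_le (θ ρ : ℝ) (l : ℕ) :
    |arCoeff θ ρ (l + 1)| ≤ ((l : ℝ) + 1) * max |θ| |ρ| ^ l := by
  induction l with
  | zero => simp [arCoeff]
  | succ l ih =>
    have h0 : 0 ≤ max |θ| |ρ| := (abs_nonneg θ).trans (le_max_left _ _)
    calc |arCoeff θ ρ (l + 1 + 1)| = |θ * arCoeff θ ρ (l + 1) + ρ ^ (l + 1)| := rfl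
      _ ≤ |θ| * |arCoeff θ ρ (l + 1)| + |ρ| ^ (l + 1) := by
          refine (abs_add_le _ _).trans ?_
          rw [abs_mul, abs_pow]
      _ ≤ max |θ| |ρ| * (((l : ℝ) + 1) * max |θ| |ρ| ^ l) + max |θ| |ρ| ^ (l + 1) := by
          gcongr
          · exact le_max_left _ _
          · exact le_max_right _ _
      _ = _ := by
          push_cast
          ring

lemma summable_abs_arCoeff {θ ρ : ℝ} (hθ : |θ| < 1) (hρ : |ρ| < 1) :
    Summable fun l => |arCoeff θ ρ l| := by
  refine (summable_nat_add_iff 1).1 ?_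
  have hr : max |θ| |ρ| < 1 := max_lt hθ hρ
  have h0 : 0 ≤ max |θ| |ρ| := (abs_nonneg θ).trans (le_max_left _ _)
  have h1 : Summable fun l : ℕ => ((l : ℝ) + 1) * max |θ| |ρ| ^ l := by
    have h2 := (summable_pow_mul_geometric_of_norm_lt_one 1
      (by rwa [Real.norm_of_nonneg h0] : ‖max |θ| |ρ|‖ < 1)).add
      (summable_geometric_of_lt_one h0 hr)
    refine h2.congr fun l => ?_
    ring
  exact Summable.of_nonneg_of_le (fun _ => abs_nonneg _) (abs_arCoeff_succ_le θ ρ) h1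

lemma linProc_succ (c : ℕ → ℝ) (W : ℕ → Ω → ℝ) (k : ℕ) (ω : Ω) :
    linProc c W (k + 1) ω = linProc (fun j => c (j + 1)) W k ω + c 0 * W k ω := by
  simp [linProc_add c W k 1]

lemma linProc_comb (p q : ℝ) (c d : ℕ → ℝ) (W : ℕ → Ω → ℝ) (k : ℕ) (ω : Ω) :
    linProc (fun j => p * c j + q * d j) W k ω = p * linProc c W k ω + q * linProc d W k ω := by
  unfold linProc
  rw [Finset.mul_sum, Finset.mul_sum, ← Finset.sum_add_distrib]
  exact Finset.sum_congr rfl fun i _ => by ring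

section Trajectory

variable {θ ρ : ℝ} {X ε W : ℕ → Ω → ℝ}

lemma noise_eq_linProc (hε : ∀ n ω, ε (n + 1) ω = ρ * ε n ω + W n ω) (n : ℕ) (ω : Ω) :
    ε n ω = linProc (fun j => ρ ^ j) W n ω + ρ ^ n * ε 0 ω := by
  induction n with
  | zero => simp [linProc]
  | succ n ih =>
    have h := linProc_comb ρ 0 (fun j => ρ ^ j) (fun _ => 0) W n ω
    have h' : (fun j => ρ * ρ ^ j + 0 * (0 : ℝ)) = fun j => ρ ^ (j + 1) := by
      ext j
      ring
    rw [h'] at h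
    rw [hε, ih, linProc_succ, h]
    ring

/-- The observed process is a linear process in the driven noise, up to the exponentially small
influence of the initial values. -/
lemma observed_eq_linProc (hX : ∀ n ω, X (n + 1) ω = θ * X n ω + ε (n + 1) ω)
    (hε : ∀ n ω, ε (n + 1) ω = ρ * ε n ω + W n ω) (n : ℕ) (ω : Ω) :
    X n ω = linProc (fun j => arCoeff θ ρ (j + 1)) W n ω +
      (θ ^ n * X 0 ω + ρ * arCoeff θ ρ n * ε 0 ω) := by
  induction n with
  | zero => simp [linProc, arCoeff]
  | succ n ih =>
    have h := linProc_comb θ ρ (fun j => arCoeff θ ρ (j + 1)) (fun j => ρ ^ j) W n ω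
    have h' : (fun j => θ * arCoeff θ ρ (j + 1) + ρ * ρ ^ j) =
        fun j => arCoeff θ ρ (j + 1 + 1) := by
      ext j
      simp only [arCoeff]
      ring
    rw [h'] at h
    rw [hX, ih, hε, noise_eq_linProc hε n, linProc_succ, h]
    simp only [arCoeff]
    ring

lemma lag_observed_eq_linProc (hX : ∀ n ω, X (n + 1) ω = θ * X n ω + ε (n + 1) ω)
    (hε : ∀ n ω, ε (n + 1) ω = ρ * ε n ω + W n ω) (n : ℕ) (ω : Ω) :
    lag (fun k => X k ω) n = linProc (arCoeff θ ρ) W n ω +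
      lag (fun n => θ ^ n * X 0 ω + ρ * arCoeff θ ρ n * ε 0 ω) n := by
  cases n with
  | zero => simp [linProc, lag]
  | succ n =>
    simp only [lag]
    rw [observed_eq_linProc hX hε, linProc_succ]
    simp [arCoeff]

lemma innov_succ_eq (hX : ∀ n ω, X (n + 1) ω = θ * X n ω + ε (n + 1) ω)
    (hε : ∀ n ω, ε (n + 1) ω = ρ * ε n ω + W n ω) (j : ℕ) (ω : Ω) :
    innov (θ + ρ) (θ * ρ) (fun k => X k ω) (j + 1) = W (j + 1) ω := by
  simp only [innov, lag]
  have h1 := hX (j + 1) ω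
  have h2 := hX j ω
  have h3 := hε (j + 1) ω
  linear_combination h1 + h3 - ρ * h2

lemma sum_mul_innov_eq (hX : ∀ n ω, X (n + 1) ω = θ * X n ω + ε (n + 1) ω)
    (hε : ∀ n ω, ε (n + 1) ω = ρ * ε n ω + W n ω) {n : ℕ} (hn : 0 < n) (ω : Ω) (g : ℕ → ℝ) :
    ∑ j ∈ Finset.range n, g j * innov (θ + ρ) (θ * ρ) (fun k => X k ω) j =
      ∑ j ∈ Finset.range n, g j * W j ω +
        g 0 * (innov (θ + ρ) (θ * ρ) (fun k => X k ω) 0 - W 0 ω) := by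
  obtain ⟨m, rfl⟩ := Nat.exists_eq_succ_of_ne_zero hn.ne'
  rw [Finset.sum_range_succ', Finset.sum_range_succ']
  simp_rw [innov_succ_eq hX hε]
  ring

lemma sum_innov_sq_eq (hX : ∀ n ω, X (n + 1) ω = θ * X n ω + ε (n + 1) ω)
    (hε : ∀ n ω, ε (n + 1) ω = ρ * ε n ω + W n ω) {n : ℕ} (hn : 0 < n) (ω : Ω) :
    ∑ j ∈ Finset.range n, innov (θ + ρ) (θ * ρ) (fun k => X k ω) j ^ 2 =
      ∑ j ∈ Finset.range n, W j ω ^ 2 +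
        (innov (θ + ρ) (θ * ρ) (fun k => X k ω) 0 ^ 2 - W 0 ω ^ 2) := by
  obtain ⟨m, rfl⟩ := Nat.exists_eq_succ_of_ne_zero hn.ne'
  rw [Finset.sum_range_succ', Finset.sum_range_succ']
  simp_rw [innov_succ_eq hX hε]
  ring

end Trajectory

variable [MeasurableSpace Ω] {μ : Measure Ω} [IsProbabilityMeasure μ]

lemma bddInProb_of_abs_le_mul {f : ℕ → Ω → ℝ} {R : Ω → ℝ} {τ : ℕ → ℝ} (hR : Measurable R)
    (hτ : Summable τ) (hτ0 : ∀ j, 0 ≤ τ j) (hf : ∀ j ω, |f j ω| ≤ R ω * τ j) :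
    BddInProb μ f := by
  refine ((BddInProb.of_randomVariable hR.aemeasurable).mul
    (BddInProb.const (∑' j, τ j))).mono (Eventually.of_forall fun n ω => ?_)
  refine (hf n ω).trans ((le_abs_self _).trans ?_)
  rw [abs_mul, abs_mul]
  refine mul_le_mul_of_nonneg_left ?_ (abs_nonneg _)
  rw [abs_of_nonneg (hτ0 n)]
  exact (hτ.le_tsum n fun j _ => hτ0 j).trans (le_abs_self _)

namespace CenteredIID

variable {W : ℕ → Ω → ℝ} {v : ℝ} (hW : CenteredIID W v μ)
include hW

/-- A transient process, bounded by a summable sequence up to a random factor, contributes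
`O_P(1)` to the sums against the noise. -/
lemma bddInProb_sum_mul_of_abs_le_mul {f : ℕ → Ω → ℝ} {R : Ω → ℝ} {τ : ℕ → ℝ} (hR : Measurable R)
    (hτ : Summable τ) (hτ0 : ∀ j, 0 ≤ τ j) (hf : ∀ j ω, |f j ω| ≤ R ω * τ j) :
    BddInProb μ (fun n ω => ∑ j ∈ Finset.range n, f j ω * W j ω) := by
  have hint : ∀ j, Integrable (fun ω => τ j * |W j ω|) μ := fun j =>
    ((hW.memLp j).integrable (by norm_num)).abs.const_mul _
  have h1 : BddInProb μ (fun n ω => ∑ j ∈ Finset.range n, τ j * |W j ω|) := by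
    refine BddInProb.of_integral_abs_le (C := (∑' j, τ j) * ∫ ω, |W 0 ω| ∂μ)
      (fun n => integrable_finsetSum _ fun j _ => hint j) fun n => ?_
    have habs : ∀ ω, |(∑ j ∈ Finset.range n, τ j * |W j ω|)| =
        ∑ j ∈ Finset.range n, τ j * |W j ω| := fun ω =>
      abs_of_nonneg (Finset.sum_nonneg fun j _ => mul_nonneg (hτ0 j) (abs_nonneg _))
    simp_rw [habs]
    rw [integral_finsetSum _ fun j _ => hint j]
    have h2 : ∀ j, ∫ ω, |W j ω| ∂μ = ∫ ω, |W 0 ω| ∂μ := fun j =>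
      ((hW.ident j).comp (u := fun x => |x|) (by fun_prop)).integral_eq
    simp_rw [integral_const_mul, h2]
    rw [← Finset.sum_mul]
    exact mul_le_mul_of_nonneg_right (hτ.sum_le_tsum _ fun j _ => hτ0 j)
      (integral_nonneg fun _ => abs_nonneg _)
  refine ((BddInProb.of_randomVariable hR.aemeasurable).mul h1).mono
    (Eventually.of_forall fun n ω => ?_)
  refine le_trans ?_ (le_abs_self _)
  rw [Finset.mul_sum]
  refine (Finset.abs_sum_le_sum_abs _ _).trans (Finset.sum_le_sum fun j _ => ?_)
  rw [abs_mul, ← mul_assoc]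
  exact mul_le_mul_of_nonneg_right (hf j ω) (abs_nonneg _)

lemma tendstoInMeasure_sum_sq :
    TendstoInMeasure μ (fun (n : ℕ) ω => (n : ℝ)⁻¹ * ∑ j ∈ Finset.range n, W j ω ^ 2) atTop
      (fun _ => v) := by
  have h := strong_law_ae_real (μ := μ) (fun j ω => W j ω ^ 2)
    (hW.memLp_two 0).integrable_sq
    (fun i j hij => (hW.indep.indepFun hij).comp (φ := fun x => x ^ 2) (ψ := fun x => x ^ 2)
      (by fun_prop) (by fun_prop))
    (fun i => (hW.ident i).comp (u := fun x => x ^ 2) (by fun_prop))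
  refine tendstoInMeasure_of_tendsto_ae (fun n => ?_) ?_
  · exact ((Finset.measurable_sum _ fun j _ => (hW.measurable j).pow_const 2).const_mul
      _).aestronglyMeasurable
  · filter_upwards [h] with ω hω
    rw [hW.integral_sq_zero] at hω
    simpa only [div_eq_inv_mul] using hω

end CenteredIID

end DurbinWatson

namespace DurbinWatson

/-! ### Exact algebra of the Durbin-Watson statistic -/

/-- `∑_{j < n} x j ^ 2`. -/
def sumSq (x : ℕ → ℝ) (n : ℕ) : ℝ := ∑ j ∈ Finset.range n, x j ^ 2

/-- The lag one sum `∑_{j < n} x (j + 1) x j`. -/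
def sumLagOne (x : ℕ → ℝ) (n : ℕ) : ℝ := ∑ j ∈ Finset.range n, x (j + 1) * x j

/-- The lag two sum `∑_{1 ≤ j < n} x (j + 1) x (j - 1)`. -/
def sumLagTwo (x : ℕ → ℝ) (n : ℕ) : ℝ := ∑ j ∈ Finset.range n, x (j + 1) * lag x j

section Algebra

variable (x : ℕ → ℝ) (n : ℕ)

lemma sum_mul_lag : ∑ j ∈ Finset.range n, x j * lag x j = sumLagOne x n - x n * lag x n := by
  induction n with
  | zero => simp [sumLagOne, lag]
  | succ n ih =>
    rw [Finset.sum_range_succ, ih, sumLagOne, sumLagOne, Finset.sum_range_succ]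
    simp only [lag]
    ring

lemma sum_lag_sq : ∑ j ∈ Finset.range n, lag x j ^ 2 = sumSq x n - lag x n ^ 2 := by
  induction n with
  | zero => simp [sumSq, lag]
  | succ n ih =>
    rw [Finset.sum_range_succ, ih, sumSq, sumSq, Finset.sum_range_succ]
    simp only [lag]
    ring

/-- The first Yule-Walker equation in the sample. -/
lemma sumLagOne_eq (a b : ℝ) : (1 + b) * sumLagOne x n = a * sumSq x n +
    (∑ j ∈ Finset.range n, x j * innov a b x j + b * (x n * lag x n)) := by
  have h1 : sumLagOne x n = a * sumSq x n - b * ∑ j ∈ Finset.range n, x j * lag x j +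
      ∑ j ∈ Finset.range n, x j * innov a b x j := by
    unfold sumLagOne sumSq innov
    rw [Finset.mul_sum, Finset.mul_sum, ← Finset.sum_sub_distrib, ← Finset.sum_add_distrib]
    exact Finset.sum_congr rfl fun j _ => by ring
  rw [sum_mul_lag] at h1
  linear_combination h1

/-- The second Yule-Walker equation in the sample. -/
lemma sumLagTwo_eq (a b : ℝ) : sumLagTwo x n = a * sumLagOne x n - b * sumSq x n +
    (∑ j ∈ Finset.range n, lag x j * innov a b x j - a * (x n * lag x n) +
      b * lag x n ^ 2) := by
  have h1 : sumLagTwo x n = a * ∑ j ∈ Finset.range n, x j * lag x j -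
      b * ∑ j ∈ Finset.range n, lag x j ^ 2 +
      ∑ j ∈ Finset.range n, lag x j * innov a b x j := by
    unfold sumLagTwo innov
    rw [Finset.mul_sum, Finset.mul_sum, ← Finset.sum_sub_distrib, ← Finset.sum_add_distrib]
    exact Finset.sum_congr rfl fun j _ => by ring
  rw [sum_mul_lag, sum_lag_sq] at h1
  linear_combination h1

/-- The energy balance obtained by squaring the autoregression, with the lag one sum eliminated
through the first Yule-Walker equation. -/
lemma sumSq_balance (a b : ℝ) :
    (1 - b) * ((1 + b) ^ 2 - a ^ 2) * sumSq x n =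
      (1 + b) * ∑ j ∈ Finset.range n, innov a b x j ^ 2 +
      ((1 + b) * (2 * a * ∑ j ∈ Finset.range n, x j * innov a b x j -
        2 * b * ∑ j ∈ Finset.range n, lag x j * innov a b x j + x 0 ^ 2 - x n ^ 2 -
        b ^ 2 * lag x n ^ 2 + 2 * a * b * (x n * lag x n)) -
      2 * a * b * (∑ j ∈ Finset.range n, x j * innov a b x j + b * (x n * lag x n))) := by
  have h1 := Finset.sum_range_succ (fun j => x j ^ 2) n
  rw [Finset.sum_range_succ'] at h1
  have h2 : ∑ j ∈ Finset.range n, x (j + 1) ^ 2 = a ^ 2 * sumSq x n +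
      b ^ 2 * ∑ j ∈ Finset.range n, lag x j ^ 2 -
      2 * a * b * ∑ j ∈ Finset.range n, x j * lag x j +
      ∑ j ∈ Finset.range n, innov a b x j ^ 2 +
      2 * a * ∑ j ∈ Finset.range n, x j * innov a b x j -
      2 * b * ∑ j ∈ Finset.range n, lag x j * innov a b x j := by
    unfold sumSq innov
    simp only [Finset.mul_sum, ← Finset.sum_sub_distrib, ← Finset.sum_add_distrib]
    exact Finset.sum_congr rfl fun j _ => by ring
  rw [sum_mul_lag, sum_lag_sq] at h2
  have h3 := sumLagOne_eq x n a b
  have h4 : ∑ j ∈ Finset.range n, x j ^ 2 = sumSq x n := rfl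
  rw [h4] at h1
  linear_combination (1 + b) * h2 - (1 + b) * h1 - 2 * a * b * h3

lemma sum_Icc_one_eq (g : ℕ → ℝ) :
    ∑ k ∈ Finset.Icc 1 n, g k = ∑ j ∈ Finset.range n, g (j + 1) := by
  induction n with
  | zero => simp
  | succ n ih => rw [Finset.sum_Icc_succ_top (by omega), ih, Finset.sum_range_succ]

lemma thetaHat_eq : thetaHat x n = sumLagOne x n / sumSq x n := by
  simp [thetaHat, sum_Icc_one_eq, sumLagOne, sumSq]

/-- The normal equation of least squares; it also holds when the denominator of the estimator
vanishes. -/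
lemma thetaHat_mul_sumSq : thetaHat x n * sumSq x n = sumLagOne x n := by
  rw [thetaHat_eq]
  by_cases h : sumSq x n = 0
  · have hz : ∀ j ∈ Finset.range n, x j = 0 := fun j hj => by
      simpa using (Finset.sum_eq_zero_iff_of_nonneg fun _ _ => sq_nonneg _).1 h j hj
    have : sumLagOne x n = 0 := Finset.sum_eq_zero fun j hj => by rw [hz j hj, mul_zero]
    rw [h, this, mul_zero]
  · rw [div_mul_cancel₀ _ h]

lemma residual_eq (k : ℕ) : residual x n k = x k - thetaHat x n * lag x k := by
  cases k <;> simp [residual, lag]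

/-- The residual sum of squares of the regression with slope `t`. -/
lemma sum_residual_sq (t : ℝ) : ∑ k ∈ Finset.range (n + 1), (x k - t * lag x k) ^ 2 =
    sumSq x n + x n ^ 2 - 2 * t * sumLagOne x n + t ^ 2 * sumSq x n := by
  induction n with
  | zero => simp [sumSq, sumLagOne, lag]
  | succ n ih =>
    rw [Finset.sum_range_succ, ih]
    simp only [sumSq, sumLagOne, Finset.sum_range_succ, lag]
    ring

lemma sum_residual_diff_sq (t : ℝ) :
    ∑ j ∈ Finset.range n, (x (j + 1) - t * lag x (j + 1) - (x j - t * lag x j)) ^ 2 =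
      2 * (sumSq x n + x n ^ 2 - 2 * t * sumLagOne x n + t ^ 2 * sumSq x n) -
      x 0 ^ 2 - (x n - t * lag x n) ^ 2 -
      2 * (sumLagOne x n - t * sumLagTwo x n - t * sumSq x n +
        t ^ 2 * (sumLagOne x n - x n * lag x n)) := by
  induction n with
  | zero => simp [sumSq, sumLagOne, sumLagTwo, lag]; ring
  | succ n ih =>
    rw [Finset.sum_range_succ, ih]
    simp only [sumSq, sumLagOne, sumLagTwo, Finset.sum_range_succ, lag]
    ring

/-- The residual sum of squares, that is, the denominator of the Durbin-Watson statistic. -/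
noncomputable def residualSumSq (x : ℕ → ℝ) (n : ℕ) : ℝ :=
  ∑ k ∈ Finset.range (n + 1), residual x n k ^ 2

lemma residualSumSq_eq :
    residualSumSq x n = sumSq x n * (1 - thetaHat x n ^ 2) + x n ^ 2 := by
  unfold residualSumSq
  simp_rw [residual_eq]
  rw [sum_residual_sq, ← thetaHat_mul_sumSq]
  ring

/-- The numerator of the centred Durbin-Watson statistic, with `t` the least squares estimate,
`l₁` and `l₂` the innovation sums at lags one and two, and boundary terms in `x 0`, `x n` and
`x (n - 1)`. -/
noncomputable def dwNumerator (a b t l₁ l₂ x₀ xn yn : ℝ) : ℝ :=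
  -2 * ((b * (1 - t ^ 2) / (1 + b) + t ^ 2) * l₁ - t * l₂) + (2 * t ^ 2 * (xn * yn) +
    2 * (b * a / (1 + b)) * xn ^ 2 - x₀ ^ 2 - (xn - t * yn) ^ 2)

/-- The exact expansion of the Durbin-Watson statistic around its limit. -/
lemma dwStat_sub_mul_residualSumSq {a b : ℝ} (hb : 1 + b ≠ 0) (hJ : residualSumSq x n ≠ 0) :
    (dwStat x n - 2 * (1 - b * a / (1 + b))) * residualSumSq x n =
      dwNumerator a b (thetaHat x n)
        (∑ j ∈ Finset.range n, x j * innov a b x j + b * (x n * lag x n))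
        (∑ j ∈ Finset.range n, lag x j * innov a b x j - a * (x n * lag x n) + b * lag x n ^ 2)
        (x 0) (x n) (lag x n) := by
  have h1 : dwStat x n * residualSumSq x n =
      ∑ j ∈ Finset.range n, (x (j + 1) - thetaHat x n * lag x (j + 1) -
        (x j - thetaHat x n * lag x j)) ^ 2 := by
    unfold dwStat
    rw [← residualSumSq, div_mul_cancel₀ _ hJ, sum_Icc_one_eq]
    simp_rw [Nat.add_sub_cancel, residual_eq]
  rw [sub_mul, h1, sum_residual_diff_sq, residualSumSq_eq]
  have h2 := sumLagOne_eq x n a b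
  have h3 := sumLagTwo_eq x n a b
  rw [← thetaHat_mul_sumSq] at h2 h3 ⊢
  rw [h3, ← sub_eq_iff_eq_add'.2 h2, dwNumerator]
  field_simp
  ring

end Algebra

/-! ### Second moments of the impulse response -/

section Coefficients

variable {θ ρ : ℝ}

lemma summable_arCoeff_sq (hθ : |θ| < 1) (hρ : |ρ| < 1) :
    Summable fun l => arCoeff θ ρ l ^ 2 :=
  summable_sq_of_summable_abs (summable_abs_arCoeff hθ hρ)

lemma summable_abs_arCoeff_succ (hθ : |θ| < 1) (hρ : |ρ| < 1) :
    Summable fun l => |arCoeff θ ρ (l + 1)| :=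
  (summable_nat_add_iff 1).2 (summable_abs_arCoeff hθ hρ)

lemma summable_arCoeff_mul (hθ : |θ| < 1) (hρ : |ρ| < 1) :
    Summable fun l => arCoeff θ ρ (l + 1) * arCoeff θ ρ l :=
  summable_mul_of_summable_abs (summable_abs_arCoeff_succ hθ hρ) (summable_abs_arCoeff hθ hρ)

lemma tsum_arCoeff_succ_sq (hθ : |θ| < 1) (hρ : |ρ| < 1) :
    ∑' l, arCoeff θ ρ (l + 1) ^ 2 = ∑' l, arCoeff θ ρ l ^ 2 := by
  rw [(summable_arCoeff_sq hθ hρ).tsum_eq_zero_add]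
  simp [arCoeff]

/-- The Yule-Walker equation for the impulse response. -/
lemma tsum_arCoeff_mul (hθ : |θ| < 1) (hρ : |ρ| < 1) :
    (1 + θ * ρ) * ∑' l, arCoeff θ ρ (l + 1) * arCoeff θ ρ l =
      (θ + ρ) * ∑' l, arCoeff θ ρ l ^ 2 := by
  have h := (summable_arCoeff_mul hθ hρ).tsum_eq_zero_add
  have h1 : ∀ l, arCoeff θ ρ (l + 1 + 1) * arCoeff θ ρ (l + 1) =
      (θ + ρ) * arCoeff θ ρ (l + 1) ^ 2 -
        θ * ρ * (arCoeff θ ρ (l + 1) * arCoeff θ ρ l) := fun l => by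
    rw [arCoeff_add_two]
    ring
  simp_rw [h1] at h
  rw [Summable.tsum_sub (((summable_nat_add_iff 1).2 (summable_arCoeff_sq hθ hρ)).mul_left _)
    ((summable_arCoeff_mul hθ hρ).mul_left _), tsum_mul_left, tsum_mul_left,
    tsum_arCoeff_succ_sq hθ hρ] at h
  simp only [arCoeff, mul_zero, zero_add] at h
  simp only [arCoeff]
  linear_combination h

lemma tsum_arCoeff_sq (hθ : |θ| < 1) (hρ : |ρ| < 1) :
    (1 - θ * ρ) * ((1 + θ * ρ) ^ 2 - (θ + ρ) ^ 2) * ∑' l, arCoeff θ ρ l ^ 2 = 1 + θ * ρ := by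
  have hs := summable_arCoeff_sq hθ hρ
  have h := hs.tsum_eq_zero_add
  rw [((summable_nat_add_iff 1).2 hs).tsum_eq_zero_add] at h
  have h1 : ∀ l, arCoeff θ ρ (l + 1 + 1) ^ 2 = (θ + ρ) ^ 2 * arCoeff θ ρ (l + 1) ^ 2 +
      (θ * ρ) ^ 2 * arCoeff θ ρ l ^ 2 -
        2 * (θ + ρ) * (θ * ρ) * (arCoeff θ ρ (l + 1) * arCoeff θ ρ l) := fun l => by
    rw [arCoeff_add_two]
    ring
  simp_rw [h1] at h
  have hs' := ((summable_nat_add_iff 1).2 hs)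
  rw [Summable.tsum_sub ((hs'.mul_left _).add (hs.mul_left _))
    ((summable_arCoeff_mul hθ hρ).mul_left _),
    Summable.tsum_add (hs'.mul_left _) (hs.mul_left _), tsum_mul_left, tsum_mul_left,
    tsum_mul_left, tsum_arCoeff_succ_sq hθ hρ] at h
  have h2 := tsum_arCoeff_mul hθ hρ
  have h3 : arCoeff θ ρ 0 = 0 := rfl
  have h4 : arCoeff θ ρ (0 + 1) = 1 := by simp [arCoeff]
  rw [h3, h4] at h
  linear_combination (1 + θ * ρ) * h - 2 * (θ + ρ) * (θ * ρ) * h2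

lemma one_add_mul_pos (hθ : |θ| < 1) (hρ : |ρ| < 1) : 0 < 1 + θ * ρ := by
  have h : |θ * ρ| < 1 := by
    rw [abs_mul]
    exact mul_lt_one_of_nonneg_of_lt_one_left (abs_nonneg _) hθ hρ.le
  linarith [(abs_lt.1 h).1]

lemma one_sub_mul_pos (hθ : |θ| < 1) (hρ : |ρ| < 1) : 0 < 1 - θ * ρ := by
  simpa [sub_eq_add_neg] using one_add_mul_pos hθ (by rwa [abs_neg] : |-ρ| < 1)

lemma sq_sub_sq_pos (hθ : |θ| < 1) (hρ : |ρ| < 1) : 0 < (1 + θ * ρ) ^ 2 - (θ + ρ) ^ 2 := by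
  have h1 := sub_pos.2 ((sq_lt_one_iff_abs_lt_one θ).2 hθ)
  have h2 := sub_pos.2 ((sq_lt_one_iff_abs_lt_one ρ).2 hρ)
  have := mul_pos h1 h2
  linarith [(by ring : (1 + θ * ρ) ^ 2 - (θ + ρ) ^ 2 = (1 - θ ^ 2) * (1 - ρ ^ 2))]

lemma one_sub_thetaStar_sq (hθ : |θ| < 1) (hρ : |ρ| < 1) : 1 - thetaStar θ ρ ^ 2 =
    ((1 + θ * ρ) ^ 2 - (θ + ρ) ^ 2) / (1 + θ * ρ) ^ 2 := by
  have := (one_add_mul_pos hθ hρ).ne'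
  unfold thetaStar
  field_simp

lemma one_sub_thetaStar_sq_pos (hθ : |θ| < 1) (hρ : |ρ| < 1) : 0 < 1 - thetaStar θ ρ ^ 2 := by
  rw [one_sub_thetaStar_sq hθ hρ]
  exact div_pos (sq_sub_sq_pos hθ hρ) (pow_pos (one_add_mul_pos hθ hρ) 2)

/-- The stationary variance of the observed process when the noise has variance `v`. -/
noncomputable def gammaZero (θ ρ v : ℝ) : ℝ :=
  v * (1 + θ * ρ) / ((1 - θ * ρ) * ((1 + θ * ρ) ^ 2 - (θ + ρ) ^ 2))

lemma gammaZero_pos (hθ : |θ| < 1) (hρ : |ρ| < 1) {v : ℝ} (hv : 0 < v) : 0 < gammaZero θ ρ v :=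
  div_pos (mul_pos hv (one_add_mul_pos hθ hρ))
    (mul_pos (one_sub_mul_pos hθ hρ) (sq_sub_sq_pos hθ hρ))

/-- The weight of the lag one innovation sum in the linearised Durbin-Watson statistic. -/
noncomputable def alphaStar (θ ρ : ℝ) : ℝ :=
  θ * ρ * (1 - thetaStar θ ρ ^ 2) / (1 + θ * ρ) + thetaStar θ ρ ^ 2

/-- The coefficients of the linear process that represents the linearised Durbin-Watson
statistic: the combination of the impulse responses at lags one and two, divided by the limit of
the normalised residual sum of squares. -/
noncomputable def dwCoeff (θ ρ v : ℝ) (l : ℕ) : ℝ :=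
  -2 / (gammaZero θ ρ v * (1 - thetaStar θ ρ ^ 2)) * alphaStar θ ρ * arCoeff θ ρ (l + 1) +
    2 / (gammaZero θ ρ v * (1 - thetaStar θ ρ ^ 2)) * thetaStar θ ρ * arCoeff θ ρ l

lemma summable_abs_dwCoeff (hθ : |θ| < 1) (hρ : |ρ| < 1) (v : ℝ) :
    Summable fun l => |dwCoeff θ ρ v l| := by
  have h1 : Summable fun l => arCoeff θ ρ (l + 1) :=
    summable_abs_iff.1 (summable_abs_arCoeff_succ hθ hρ)
  have h2 : Summable fun l => arCoeff θ ρ l := summable_abs_iff.1 (summable_abs_arCoeff hθ hρ)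
  exact summable_abs_iff.2 ((h1.mul_left _).add (h2.mul_left _))

/-- The asymptotic variance. -/
lemma sq_mul_tsum_dwCoeff_sq (hθ : |θ| < 1) (hρ : |ρ| < 1) {v : ℝ} (hv : 0 < v) :
    v ^ 2 * ∑' l, dwCoeff θ ρ v l ^ 2 = sigmaDSq θ ρ := by
  have hs := summable_arCoeff_sq hθ hρ
  have hs' := (summable_nat_add_iff 1).2 hs
  have hm := summable_arCoeff_mul hθ hρ
  have hb := (one_add_mul_pos hθ hρ).ne'
  have hb' := (one_sub_mul_pos hθ hρ).ne'
  have hK := (sq_sub_sq_pos hθ hρ).ne'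
  have hexp : ∀ l, dwCoeff θ ρ v l ^ 2 =
      (2 / (gammaZero θ ρ v * (1 - thetaStar θ ρ ^ 2))) ^ 2 *
        (alphaStar θ ρ ^ 2 * arCoeff θ ρ (l + 1) ^ 2 +
          thetaStar θ ρ ^ 2 * arCoeff θ ρ l ^ 2 -
          2 * alphaStar θ ρ * thetaStar θ ρ * (arCoeff θ ρ (l + 1) * arCoeff θ ρ l)) :=
    fun l => by
      unfold dwCoeff
      ring
  simp_rw [hexp]
  rw [tsum_mul_left, Summable.tsum_sub ((hs'.mul_left _).add (hs.mul_left _)) (hm.mul_left _),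
    Summable.tsum_add (hs'.mul_left _) (hs.mul_left _), tsum_mul_left, tsum_mul_left,
    tsum_mul_left, tsum_arCoeff_succ_sq hθ hρ]
  have hG : ∑' l, arCoeff θ ρ l ^ 2 =
      (1 + θ * ρ) / ((1 - θ * ρ) * ((1 + θ * ρ) ^ 2 - (θ + ρ) ^ 2)) := by
    rw [eq_div_iff (mul_ne_zero hb' hK)]
    linear_combination tsum_arCoeff_sq hθ hρ
  have hG1 : ∑' l, arCoeff θ ρ (l + 1) * arCoeff θ ρ l =
      (θ + ρ) / (1 + θ * ρ) * ∑' l, arCoeff θ ρ l ^ 2 := by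
    rw [div_mul_eq_mul_div, eq_div_iff hb]
    linear_combination tsum_arCoeff_mul hθ hρ
  rw [hG1, hG, alphaStar, one_sub_thetaStar_sq hθ hρ, gammaZero, sigmaDSq, sigmaRhoSq, thetaStar]
  have hK' : (1 - θ ^ 2) * (1 - ρ ^ 2) = (1 + θ * ρ) ^ 2 - (θ + ρ) ^ 2 := by ring
  rw [mul_assoc ((θ * ρ) ^ 2), hK']
  have hv' := hv.ne'
  clear hs hs' hm hexp hG hG1 hK'
  generalize 1 + θ * ρ = p at *
  generalize 1 - θ * ρ = w at *
  generalize θ + ρ = a at *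
  generalize θ * ρ = b at *
  -- both sides are `4 w (b² K + a² p²) / p³` with `K = p² - a²`
  have hα : (b * ((p ^ 2 - a ^ 2) / p ^ 2) / p + (a / p) ^ 2) ^ 2 + (a / p) ^ 2 -
      2 * (b * ((p ^ 2 - a ^ 2) / p ^ 2) / p + (a / p) ^ 2) * (a / p) * (a / p) =
      (p ^ 2 - a ^ 2) * (b ^ 2 * (p ^ 2 - a ^ 2) + a ^ 2 * p ^ 2) / p ^ 6 := by
    field_simp
    ring
  have hγ : 2 / (v * p / (w * (p ^ 2 - a ^ 2)) * ((p ^ 2 - a ^ 2) / p ^ 2)) = 2 * w * p / v := by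
    field_simp
  rw [hγ]
  generalize b * ((p ^ 2 - a ^ 2) / p ^ 2) / p + (a / p) ^ 2 = α at *
  generalize p ^ 2 - a ^ 2 = K at *
  calc _ = 4 * w * p ^ 3 / K * (α ^ 2 + (a / p) ^ 2 - 2 * α * (a / p) * (a / p)) := by
        field_simp
        ring
    _ = _ := by
        rw [hα]
        field_simp
        ring

end Coefficients

end DurbinWatson

namespace DurbinWatson

/-! ### Limits in probability and asymptotic normality -/

open scoped Topology

lemma tendsto_inv_sqrt_natCast : Tendsto (fun n : ℕ => (√(n : ℝ))⁻¹) atTop (𝓝 0) :=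
  tendsto_inv_atTop_zero.comp (Real.tendsto_sqrt_atTop.comp tendsto_natCast_atTop_atTop)

lemma inv_sqrt_mul_self (n : ℕ) : (√(n : ℝ))⁻¹ * (√(n : ℝ))⁻¹ = (n : ℝ)⁻¹ := by
  rw [← mul_inv, Real.mul_self_sqrt (Nat.cast_nonneg n)]

lemma abs_transient_le (θ ρ x e : ℝ) (j : ℕ) : |θ ^ j * x + ρ * arCoeff θ ρ j * e| ≤
    (|x| + |e|) * (|θ| ^ j + |ρ| * |arCoeff θ ρ j|) := by
  refine (abs_add_le _ _).trans ?_
  rw [abs_mul, abs_mul, abs_mul, abs_pow]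
  have h1 : 0 ≤ |θ| ^ j * |e| := by positivity
  have h2 : 0 ≤ |ρ| * |arCoeff θ ρ j| * |x| := by positivity
  nlinarith

variable {Ω : Type*} [MeasurableSpace Ω] {μ : Measure Ω}

lemma BddInProb.inv_sqrt_mul {f : ℕ → Ω → ℝ} (hf : BddInProb μ f) :
    TendstoInMeasure μ (fun (n : ℕ) ω => (√(n : ℝ))⁻¹ * f n ω) atTop (fun _ => 0) :=
  hf.tendsto_zero_mul tendsto_inv_sqrt_natCast

/-- Two sequences that agree off the event that a third sequence vanishes have the same limit in
probability as soon as the third one converges to a nonzero constant. -/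
lemma tendstoInMeasure_of_eq_of_ne_zero {f g h : ℕ → Ω → ℝ} {c : ℝ} (hc : c ≠ 0)
    (hf : TendstoInMeasure μ f atTop (fun _ => 0)) (hh : TendstoInMeasure μ h atTop (fun _ => c))
    (heq : ∀ᶠ n in atTop, ∀ ω, h n ω ≠ 0 → g n ω = f n ω) :
    TendstoInMeasure μ g atTop (fun _ => 0) := by
  rw [tendstoInMeasure_const_iff] at *
  intro ε hε δ hδ
  filter_upwards [hf ε hε (δ / 2) (ENNReal.half_pos hδ.ne'),
    hh |c| (abs_pos.2 hc) (δ / 2) (ENNReal.half_pos hδ.ne'), heq] with n hn hn' he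
  have hsub : {ω | ε ≤ |g n ω - 0|} ⊆ {ω | ε ≤ |f n ω - 0|} ∪ {ω | |c| ≤ |h n ω - c|} := by
    intro ω hω
    by_cases h0 : h n ω = 0
    · right
      simp [h0]
    · left
      simpa [he ω h0] using hω
  calc _ ≤ μ {ω | ε ≤ |f n ω - 0|} + μ {ω | |c| ≤ |h n ω - c|} :=
        (measure_mono hsub).trans (measure_union_le _ _)
    _ ≤ δ / 2 + δ / 2 := add_le_add hn hn'
    _ = δ := ENNReal.add_halves δ

/-- The observed process `X` of the first order autoregression `X n = θ X (n - 1) + ε n` with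
autoregressive noise `ε n = ρ ε (n - 1) + W (n - 1)`; the driven noise `W` is indexed from `0`, and
the initial values are arbitrary random variables. -/
structure DrivenModel (θ ρ v : ℝ) (X ε W : ℕ → Ω → ℝ) (μ : Measure Ω) : Prop where
  abs_theta_lt_one : |θ| < 1
  abs_rho_lt_one : |ρ| < 1
  variance_pos : 0 < v
  noise : CenteredIID W v μ
  measurable_observed_zero : Measurable (X 0)
  measurable_noise_zero : Measurable (ε 0)
  rec_observed : ∀ n ω, X (n + 1) ω = θ * X n ω + ε (n + 1) ω
  rec_noise : ∀ n ω, ε (n + 1) ω = ρ * ε n ω + W n ω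

namespace DrivenModel

variable {θ ρ v : ℝ} {X ε W : ℕ → Ω → ℝ} (M : DrivenModel θ ρ v X ε W μ)
include M

lemma measurable_observed (n : ℕ) : Measurable (X n) := by
  have h : X n = fun ω => linProc (fun j => arCoeff θ ρ (j + 1)) W n ω +
      (θ ^ n * X 0 ω + ρ * arCoeff θ ρ n * ε 0 ω) :=
    funext fun ω => observed_eq_linProc M.rec_observed M.rec_noise n ω
  rw [h]
  exact (M.noise.measurable_linProc _ n).add
    ((M.measurable_observed_zero.const_mul _).add (M.measurable_noise_zero.const_mul _))

lemma measurable_lag (n : ℕ) : Measurable (fun ω => lag (fun k => X k ω) n) := by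
  cases n with
  | zero => exact measurable_const
  | succ n => exact M.measurable_observed n

lemma measurable_innov_zero :
    Measurable (fun ω => innov (θ + ρ) (θ * ρ) (fun k => X k ω) 0) := by
  have h0 := M.measurable_observed 0
  have h1 := M.measurable_observed (0 + 1)
  simp only [innov, lag]
  fun_prop

lemma measurable_dwStat (n : ℕ) : Measurable (fun ω => dwStat (fun k => X k ω) n) := by
  have h0 := M.measurable_observed
  have h1 := M.measurable_lag
  unfold dwStat
  simp_rw [residual_eq, thetaHat]
  fun_prop

lemma summable_transient : Summable fun j => |θ| ^ j + |ρ| * |arCoeff θ ρ j| :=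
  (summable_geometric_of_lt_one (abs_nonneg _) M.abs_theta_lt_one).add
    ((summable_abs_arCoeff M.abs_theta_lt_one M.abs_rho_lt_one).mul_left _)

variable [IsProbabilityMeasure μ]

/-- If a process is a linear process up to a transient, so are its sums against the innovations,
up to a term bounded in probability. -/
lemma bddInProb_of_transient {Y f : ℕ → Ω → ℝ} {c : ℕ → ℝ} {R : Ω → ℝ} {τ : ℕ → ℝ}
    (hc : Summable fun j => |c j|) (hY0 : Measurable (Y 0))
    (hR : Measurable R) (hτ : Summable τ) (hτ0 : ∀ j, 0 ≤ τ j)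
    (hf : ∀ j ω, |f j ω| ≤ R ω * τ j) (hY : ∀ j ω, Y j ω = linProc c W j ω + f j ω) :
    BddInProb μ Y ∧ BddInProb μ (fun n ω =>
      ∑ j ∈ Finset.range n, Y j ω * innov (θ + ρ) (θ * ρ) (fun k => X k ω) j -
        ∑ j ∈ Finset.range n, linProc c W j ω * W j ω) := by
  constructor
  · refine BddInProb.congr ((M.noise.bddInProb_linProc (summable_sq_of_summable_abs hc)).add
      (bddInProb_of_abs_le_mul hR hτ hτ0 hf)) (Eventually.of_forall hY)
  · have h0 : Measurable fun ω =>
        Y 0 ω * (innov (θ + ρ) (θ * ρ) (fun k => X k ω) 0 - W 0 ω) :=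
      hY0.mul (M.measurable_innov_zero.sub (M.noise.measurable 0))
    refine ((M.noise.bddInProb_sum_mul_of_abs_le_mul hR hτ hτ0 hf).add
      (BddInProb.of_randomVariable h0.aemeasurable)).congr ?_
    filter_upwards [eventually_gt_atTop 0] with n hn ω
    rw [sum_mul_innov_eq M.rec_observed M.rec_noise hn ω (fun j => Y j ω), add_sub_right_comm,
      ← Finset.sum_sub_distrib]
    congr 1
    refine Finset.sum_congr rfl fun j _ => ?_
    rw [hY]
    ring

lemma bddInProb_observed : BddInProb μ X ∧ BddInProb μ (fun n ω =>
    ∑ j ∈ Finset.range n, X j ω * innov (θ + ρ) (θ * ρ) (fun k => X k ω) j -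
      ∑ j ∈ Finset.range n, linProc (fun j => arCoeff θ ρ (j + 1)) W j ω * W j ω) :=
  M.bddInProb_of_transient (summable_abs_arCoeff_succ M.abs_theta_lt_one M.abs_rho_lt_one)
    M.measurable_observed_zero (M.measurable_observed_zero.abs.add M.measurable_noise_zero.abs)
    M.summable_transient
    (fun j => by positivity) (fun j ω => abs_transient_le θ ρ _ _ j)
    (observed_eq_linProc M.rec_observed M.rec_noise)

lemma bddInProb_lag : BddInProb μ (fun n ω => lag (fun k => X k ω) n) ∧ BddInProb μ (fun n ω =>
    ∑ j ∈ Finset.range n, lag (fun k => X k ω) j * innov (θ + ρ) (θ * ρ) (fun k => X k ω) j -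
      ∑ j ∈ Finset.range n, linProc (arCoeff θ ρ) W j ω * W j ω) := by
  refine M.bddInProb_of_transient (Y := fun n ω => lag (fun k => X k ω) n)
    (τ := lag fun j => |θ| ^ j + |ρ| * |arCoeff θ ρ j|)
    (summable_abs_arCoeff M.abs_theta_lt_one M.abs_rho_lt_one)
    measurable_const (M.measurable_observed_zero.abs.add M.measurable_noise_zero.abs)
    ((summable_nat_add_iff 1).1 M.summable_transient) ?_ ?_
    (lag_observed_eq_linProc M.rec_observed M.rec_noise)
  · intro j
    cases j with
    | zero => exact le_rfl
    | succ j => exact add_nonneg (by positivity) (by positivity)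
  · intro j ω
    cases j with
    | zero => simp [lag]
    | succ j => exact abs_transient_le θ ρ _ _ j

/-- Divided by `√n`, the lag one innovation sum with the boundary term of the Yule-Walker equation
differs from the corresponding normalised martingale of the linear process by `o_P(1)`. -/
lemma tendstoInMeasure_lagOne : TendstoInMeasure μ (fun (n : ℕ) ω => (√(n : ℝ))⁻¹ *
    (∑ j ∈ Finset.range n, X j ω * innov (θ + ρ) (θ * ρ) (fun k => X k ω) j +
      θ * ρ * (X n ω * lag (fun k => X k ω) n)) -
    (√(n : ℝ))⁻¹ * ∑ j ∈ Finset.range n, linProc (fun j => arCoeff θ ρ (j + 1)) W j ω * W j ω)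
    atTop (fun _ => 0) := by
  obtain ⟨hx, hM⟩ := M.bddInProb_observed
  refine tendstoInMeasure_congr_left
    (hM.add ((hx.mul M.bddInProb_lag.1).const_mul (θ * ρ))).inv_sqrt_mul
    (Eventually.of_forall fun n ω => ?_)
  ring

lemma tendstoInMeasure_lagTwo : TendstoInMeasure μ (fun (n : ℕ) ω => (√(n : ℝ))⁻¹ *
    (∑ j ∈ Finset.range n, lag (fun k => X k ω) j * innov (θ + ρ) (θ * ρ) (fun k => X k ω) j -
      (θ + ρ) * (X n ω * lag (fun k => X k ω) n) + θ * ρ * lag (fun k => X k ω) n ^ 2) -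
    (√(n : ℝ))⁻¹ * ∑ j ∈ Finset.range n, linProc (arCoeff θ ρ) W j ω * W j ω)
    atTop (fun _ => 0) := by
  obtain ⟨hy, hM⟩ := M.bddInProb_lag
  refine tendstoInMeasure_congr_left
    ((hM.sub ((M.bddInProb_observed.1.mul hy).const_mul (θ + ρ))).add
      ((hy.mul hy).const_mul (θ * ρ))).inv_sqrt_mul
    (Eventually.of_forall fun n ω => ?_)
  ring

lemma bddInProb_lagOne : BddInProb μ (fun (n : ℕ) ω => (√(n : ℝ))⁻¹ *
    (∑ j ∈ Finset.range n, X j ω * innov (θ + ρ) (θ * ρ) (fun k => X k ω) j +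
      θ * ρ * (X n ω * lag (fun k => X k ω) n))) :=
  ((BddInProb.of_tendstoInMeasure M.tendstoInMeasure_lagOne).add
    (M.noise.bddInProb_inv_sqrt_mul_sum (summable_sq_of_summable_abs
      (summable_abs_arCoeff_succ M.abs_theta_lt_one M.abs_rho_lt_one)))).congr
    (Eventually.of_forall fun n ω => by ring)

lemma bddInProb_lagTwo : BddInProb μ (fun (n : ℕ) ω => (√(n : ℝ))⁻¹ *
    (∑ j ∈ Finset.range n, lag (fun k => X k ω) j * innov (θ + ρ) (θ * ρ) (fun k => X k ω) j -
      (θ + ρ) * (X n ω * lag (fun k => X k ω) n) + θ * ρ * lag (fun k => X k ω) n ^ 2)) :=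
  ((BddInProb.of_tendstoInMeasure M.tendstoInMeasure_lagTwo).add
    (M.noise.bddInProb_inv_sqrt_mul_sum (summable_sq_of_summable_abs
      (summable_abs_arCoeff M.abs_theta_lt_one M.abs_rho_lt_one)))).congr
    (Eventually.of_forall fun n ω => by ring)

/-- The law of large numbers for the squares of the observed process, from the energy balance of
the autoregression. -/
lemma tendstoInMeasure_sumSq :
    TendstoInMeasure μ (fun (n : ℕ) ω => (n : ℝ)⁻¹ * sumSq (fun k => X k ω) n) atTop
      (fun _ => gammaZero θ ρ v) := by
  have hx := M.bddInProb_observed.1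
  have hy := M.bddInProb_lag.1
  have hL1 := M.bddInProb_lagOne
  have hL2 := M.bddInProb_lagTwo
  have hx0 := BddInProb.of_randomVariable (μ := μ) M.measurable_observed_zero.aemeasurable
  have hr := BddInProb.of_tendstoInMeasure (μ := μ)
    (tendstoInMeasure_of_tendsto tendsto_inv_sqrt_natCast)
  have hi0 : BddInProb μ (fun _ ω =>
      innov (θ + ρ) (θ * ρ) (fun k => X k ω) 0 ^ 2 - W 0 ω ^ 2) := BddInProb.of_randomVariable
    ((M.measurable_innov_zero.pow_const 2).sub ((M.noise.measurable 0).pow_const 2)).aemeasurable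
  have hK := mul_pos (one_sub_mul_pos M.abs_theta_lt_one M.abs_rho_lt_one)
    (sq_sub_sq_pos M.abs_theta_lt_one M.abs_rho_lt_one)
  -- the remainder in the energy balance, divided by `√n`
  have hE := ((((hL1.const_mul (2 * (θ + ρ) * (1 + θ * ρ) - 2 * (θ + ρ) * (θ * ρ))).sub
    (hL2.const_mul (2 * (θ * ρ) * (1 + θ * ρ)))).add
    (hr.mul (((hx0.mul hx0).sub (hx.mul hx)).const_mul (1 + θ * ρ)))).sub
    (hr.mul ((hx.mul hy).const_mul (2 * (θ + ρ) * (θ * ρ) * (1 + θ * ρ))))).add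
    (hr.mul ((hy.mul hy).const_mul ((1 + θ * ρ) * (θ * ρ) ^ 2)))
  have hmain := tendstoInMeasure_const_mul
    (((1 - θ * ρ) * ((1 + θ * ρ) ^ 2 - (θ + ρ) ^ 2))⁻¹)
    (tendstoInMeasure_add (tendstoInMeasure_const_mul (1 + θ * ρ)
      (tendstoInMeasure_add M.noise.tendstoInMeasure_sum_sq
        (hr.mul hi0).inv_sqrt_mul)) hE.inv_sqrt_mul)
  have hlim : ((1 - θ * ρ) * ((1 + θ * ρ) ^ 2 - (θ + ρ) ^ 2))⁻¹ * ((1 + θ * ρ) * (v + 0) + 0) =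
      gammaZero θ ρ v := by
    rw [gammaZero, div_eq_mul_inv]
    ring
  rw [hlim] at hmain
  refine tendstoInMeasure_congr_left hmain ?_
  filter_upwards [eventually_gt_atTop 0] with n hn ω
  have h1 := sumSq_balance (fun k => X k ω) n (θ + ρ) (θ * ρ)
  rw [sum_innov_sq_eq M.rec_observed M.rec_noise hn] at h1
  rw [← inv_sqrt_mul_self n, eq_inv_mul_iff_mul_eq₀ hK.ne']
  linear_combination (√(n : ℝ))⁻¹ * (√(n : ℝ))⁻¹ * h1

/-- Consistency of the least squares estimator, towards `θ*` rather than `θ`. -/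
lemma tendstoInMeasure_thetaHat :
    TendstoInMeasure μ (fun (n : ℕ) ω => thetaHat (fun k => X k ω) n) atTop
      (fun _ => thetaStar θ ρ) := by
  have hb := (one_add_mul_pos M.abs_theta_lt_one M.abs_rho_lt_one).ne'
  have hγ := (gammaZero_pos M.abs_theta_lt_one M.abs_rho_lt_one M.variance_pos).ne'
  have hP := tendstoInMeasure_const_mul (1 + θ * ρ)⁻¹ (tendstoInMeasure_add
    (tendstoInMeasure_const_mul (θ + ρ) M.tendstoInMeasure_sumSq)
    M.bddInProb_lagOne.inv_sqrt_mul)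
  have hdiv := tendstoInMeasure_div hP M.tendstoInMeasure_sumSq hγ
  have hlim : (1 + θ * ρ)⁻¹ * ((θ + ρ) * gammaZero θ ρ v + 0) / gammaZero θ ρ v =
      thetaStar θ ρ := by
    unfold thetaStar
    field_simp
    ring
  rw [hlim] at hdiv
  refine tendstoInMeasure_congr_left hdiv ?_
  filter_upwards [eventually_gt_atTop 0] with n hn ω
  have hn' : ((n : ℝ)⁻¹) ≠ 0 := by positivity
  rw [thetaHat_eq, ← mul_div_mul_left _ _ hn']
  congr 1
  rw [eq_inv_mul_iff_mul_eq₀ hb]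
  have h1 := sumLagOne_eq (fun k => X k ω) n (θ + ρ) (θ * ρ)
  rw [← inv_sqrt_mul_self n]
  linear_combination (√(n : ℝ))⁻¹ * (√(n : ℝ))⁻¹ * h1

lemma tendstoInMeasure_residualSumSq :
    TendstoInMeasure μ (fun (n : ℕ) ω => (n : ℝ)⁻¹ * residualSumSq (fun k => X k ω) n) atTop
      (fun _ => gammaZero θ ρ v * (1 - thetaStar θ ρ ^ 2)) := by
  have hx := M.bddInProb_observed.1
  have hr := BddInProb.of_tendstoInMeasure (μ := μ)
    (tendstoInMeasure_of_tendsto tendsto_inv_sqrt_natCast)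
  have h := tendstoInMeasure_add (tendstoInMeasure_mul M.tendstoInMeasure_sumSq
    (tendstoInMeasure_comp (g := fun t => 1 - t ^ 2) M.tendstoInMeasure_thetaHat (by fun_prop)))
    (hr.mul (hx.mul hx)).inv_sqrt_mul
  rw [add_zero] at h
  refine tendstoInMeasure_congr_left h (Eventually.of_forall fun n ω => ?_)
  rw [residualSumSq_eq, ← inv_sqrt_mul_self n]
  ring

/-- The numerator of the centred Durbin-Watson statistic is asymptotically linear in the two
innovation martingales: the estimator may be replaced by its limit, and the boundary terms are
negligible. -/
lemma tendstoInMeasure_dwNumerator :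
    TendstoInMeasure μ (fun (n : ℕ) ω => (√(n : ℝ))⁻¹ *
      dwNumerator (θ + ρ) (θ * ρ) (thetaHat (fun k => X k ω) n)
        (∑ j ∈ Finset.range n, X j ω * innov (θ + ρ) (θ * ρ) (fun k => X k ω) j +
          θ * ρ * (X n ω * lag (fun k => X k ω) n))
        (∑ j ∈ Finset.range n,
            lag (fun k => X k ω) j * innov (θ + ρ) (θ * ρ) (fun k => X k ω) j -
          (θ + ρ) * (X n ω * lag (fun k => X k ω) n) + θ * ρ * lag (fun k => X k ω) n ^ 2)
        (X 0 ω) (X n ω) (lag (fun k => X k ω) n) -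
      (-2) * (alphaStar θ ρ *
        ((√(n : ℝ))⁻¹ * ∑ j ∈ Finset.range n,
          linProc (fun j => arCoeff θ ρ (j + 1)) W j ω * W j ω) -
        thetaStar θ ρ *
          ((√(n : ℝ))⁻¹ * ∑ j ∈ Finset.range n, linProc (arCoeff θ ρ) W j ω * W j ω)))
      atTop (fun _ => 0) := by
  have hx := M.bddInProb_observed.1
  have hy := M.bddInProb_lag.1
  have hx0 := BddInProb.of_randomVariable (μ := μ) M.measurable_observed_zero.aemeasurable
  have ht := M.tendstoInMeasure_thetaHat
  have htb := BddInProb.of_tendstoInMeasure ht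
  have hA := tendstoInMeasure_iff_sub.1 (tendstoInMeasure_comp
    (g := fun t => θ * ρ * (1 - t ^ 2) / (1 + θ * ρ) + t ^ 2) ht (by fun_prop))
  have h1 := M.bddInProb_lagOne.mul_tendsto_zero hA
  have h2 := tendstoInMeasure_const_mul (alphaStar θ ρ) M.tendstoInMeasure_lagOne
  have h3 := M.bddInProb_lagTwo.mul_tendsto_zero (tendstoInMeasure_iff_sub.1 ht)
  have h4 := tendstoInMeasure_const_mul (thetaStar θ ρ) M.tendstoInMeasure_lagTwo
  have hrem := (((((htb.mul htb).mul (hx.mul hy)).const_mul 2).add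
    ((hx.mul hx).const_mul (2 * (θ * ρ * (θ + ρ) / (1 + θ * ρ))))).sub
    ((hx0.mul hx0).add ((hx.sub (htb.mul hy)).mul (hx.sub (htb.mul hy))))).inv_sqrt_mul
  have h := tendstoInMeasure_add (tendstoInMeasure_const_mul (-2) (tendstoInMeasure_add
    (tendstoInMeasure_add h1 h2)
    (tendstoInMeasure_const_mul (-1) (tendstoInMeasure_add h3 h4)))) hrem
  simp only [mul_zero, add_zero] at h
  refine tendstoInMeasure_congr_left h (Eventually.of_forall fun n ω => ?_)
  simp only [dwNumerator, alphaStar]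
  ring

/-- The Durbin-Watson statistic is asymptotically linear in the noise martingale with coefficient
sequence `dwCoeff`. -/
lemma tendstoInMeasure_sqrt_mul_dwStat_sub :
    TendstoInMeasure μ (fun (n : ℕ) ω =>
      √(n : ℝ) * (dwStat (fun k => X k ω) n - dStar θ ρ) -
        (√(n : ℝ))⁻¹ * ∑ j ∈ Finset.range n, linProc (dwCoeff θ ρ v) W j ω * W j ω)
      atTop (fun _ => 0) := by
  have hb := (one_add_mul_pos M.abs_theta_lt_one M.abs_rho_lt_one).ne'
  have hγ := mul_pos (gammaZero_pos M.abs_theta_lt_one M.abs_rho_lt_one M.variance_pos)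
    (one_sub_thetaStar_sq_pos M.abs_theta_lt_one M.abs_rho_lt_one)
  have hJ := M.tendstoInMeasure_residualSumSq
  have hJi := tendstoInMeasure_comp hJ (continuousAt_inv₀ hγ.ne')
  have hG1 := M.noise.bddInProb_inv_sqrt_mul_sum (summable_sq_of_summable_abs
    (summable_abs_arCoeff_succ M.abs_theta_lt_one M.abs_rho_lt_one))
  have hG2 := M.noise.bddInProb_inv_sqrt_mul_sum (summable_sq_of_summable_abs
    (summable_abs_arCoeff M.abs_theta_lt_one M.abs_rho_lt_one))
  have hG := ((hG1.const_mul (alphaStar θ ρ)).sub (hG2.const_mul (thetaStar θ ρ))).const_mul (-2)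
  have h := tendstoInMeasure_add
    (tendstoInMeasure_mul M.tendstoInMeasure_dwNumerator hJi)
    (hG.mul_tendsto_zero (tendstoInMeasure_iff_sub.1 hJi))
  rw [zero_mul, add_zero] at h
  refine tendstoInMeasure_of_eq_of_ne_zero hγ.ne' h hJ ?_
  filter_upwards [eventually_gt_atTop 0] with n hn ω hne
  have hn' : (0 : ℝ) < n := by exact_mod_cast hn
  have hJ0 : residualSumSq (fun k => X k ω) n ≠ 0 := right_ne_zero_of_mul hne
  have hdw := dwStat_sub_mul_residualSumSq (fun k => X k ω) n (a := θ + ρ) hb hJ0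
  have hd : dStar θ ρ = 2 * (1 - θ * ρ * (θ + ρ) / (1 + θ * ρ)) := by
    unfold dStar rhoStar thetaStar
    ring
  rw [← hd] at hdw
  have hlin : ∑ j ∈ Finset.range n, linProc (dwCoeff θ ρ v) W j ω * W j ω =
      -2 * (gammaZero θ ρ v * (1 - thetaStar θ ρ ^ 2))⁻¹ * (alphaStar θ ρ *
        ∑ j ∈ Finset.range n, linProc (fun j => arCoeff θ ρ (j + 1)) W j ω * W j ω -
        thetaStar θ ρ * ∑ j ∈ Finset.range n, linProc (arCoeff θ ρ) W j ω * W j ω) := by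
    simp only [Finset.mul_sum, ← Finset.sum_sub_distrib]
    refine Finset.sum_congr rfl fun j _ => ?_
    have := linProc_comb
      (-2 / (gammaZero θ ρ v * (1 - thetaStar θ ρ ^ 2)) * alphaStar θ ρ)
      (2 / (gammaZero θ ρ v * (1 - thetaStar θ ρ ^ 2)) * thetaStar θ ρ)
      (fun j => arCoeff θ ρ (j + 1)) (arCoeff θ ρ) W j ω
    have hc : linProc (dwCoeff θ ρ v) W j ω = _ := this
    rw [hc]
    ring
  have hmain : √(n : ℝ) * (dwStat (fun k => X k ω) n - dStar θ ρ) =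
      (√(n : ℝ))⁻¹ * ((dwStat (fun k => X k ω) n - dStar θ ρ) *
        residualSumSq (fun k => X k ω) n) * ((n : ℝ)⁻¹ * residualSumSq (fun k => X k ω) n)⁻¹ := by
    field_simp
    rw [Real.sq_sqrt hn'.le]
    ring
  rw [hmain, hdw, hlin]
  ring

/-- Asymptotic normality of the Durbin-Watson statistic. -/
theorem tendstoInDistribution_dwStat :
    TendstoInDistribution
      (fun (n : ℕ) (ω : Ω) => √(n : ℝ) * (dwStat (fun k => X k ω) n - dStar θ ρ))
      atTop (id : ℝ → ℝ) (fun _ => μ) (gaussianReal 0 (sigmaDSq θ ρ).toNNReal) := by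
  have h := M.noise.tendstoInDistribution_linProc_mul
    (summable_abs_dwCoeff M.abs_theta_lt_one M.abs_rho_lt_one v)
  rw [sq_mul_tsum_dwCoeff_sq M.abs_theta_lt_one M.abs_rho_lt_one M.variance_pos] at h
  exact tendstoInDistribution_of_tendstoInMeasure_sub _ _ h M.tendstoInMeasure_sqrt_mul_dwStat_sub
    fun n => (((M.measurable_dwStat n).sub_const _).const_mul _).aemeasurable

end DrivenModel

end DurbinWatson

theorem theorem4p2 {Ω : Type*} [MeasurableSpace Ω] (μ : Measure Ω) [IsProbabilityMeasure μ]
    (θ ρ : ℝ) (hθ : |θ| < 1) (hρ : |ρ| < 1)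
    -- the observed process, the serially correlated noise, and the driven noise
    (X ε V : ℕ → Ω → ℝ)
    -- the initial values are arbitrary random variables
    (hX0 : Measurable (X 0)) (hε0 : Measurable (ε 0))
    (hX : ∀ n, 1 ≤ n → ∀ ω, X n ω = θ * X (n - 1) ω + ε n ω)
    (hε : ∀ n, 1 ≤ n → ∀ ω, ε n ω = ρ * ε (n - 1) ω + V n ω)
    -- `V 1, V 2, …` are i.i.d., centered, with positive variance and finite fourth moment
    (hVmeas : ∀ n, 1 ≤ n → Measurable (V n))
    (hVindep : iIndepFun (fun n => V (n + 1)) μ)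
    (hVident : ∀ n, 1 ≤ n → IdentDistrib (V n) (V 1) μ μ)
    (hVmean : ∫ ω, V 1 ω ∂μ = 0)
    (hVvar : 0 < variance (V 1) μ)
    (hV4 : MemLp (V 1) 4 μ) :
    TendstoInDistribution
      (fun (n : ℕ) (ω : Ω) =>
        Real.sqrt n * (DurbinWatson.dwStat (fun k => X k ω) n - DurbinWatson.dStar θ ρ))
      atTop (id : ℝ → ℝ) (fun _ => μ)
      (gaussianReal 0 (DurbinWatson.sigmaDSq θ ρ).toNNReal) := by
  have M : DurbinWatson.DrivenModel θ ρ (variance (V 1) μ) X ε (fun n => V (n + 1)) μ :=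
    { abs_theta_lt_one := hθ
      abs_rho_lt_one := hρ
      variance_pos := hVvar
      noise :=
        { measurable := fun k => hVmeas (k + 1) (by omega)
          indep := hVindep
          ident := fun k => hVident (k + 1) (by omega)
          memLp_zero := hV4.mono_exponent (by norm_num)
          integral_zero := hVmean
          integral_sq_zero :=
            (variance_of_integral_eq_zero (hVmeas 1 le_rfl).aemeasurable hVmean).symm }
      measurable_observed_zero := hX0
      measurable_noise_zero := hε0
      rec_observed := fun n => hX (n + 1) (by omega)
      rec_noise := fun n => hε (n + 1) (by omega) }
  exact M.tendstoInDistribution_dwStat
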